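/- Let $G$ be a finite simple directed strongly connected graph with vertex set $V$ (totally ordered, so that rows and columns of matrices are ordered), and let $R$ be a commutative unital ring. A cut-vertex is a vertex whose removal disconnects the underlying undirected graph; the strong blocks $G_e$ ($e \in E$) are the maximal connected subgraphs without cut-vertices. Let $\mathcal{G} = \{(a_e, D^*_{G_e}) : e \in E\}$ be a block-datum: $a_e \in R$, and $D^*_{G_e}$ is a square matrix over $R$ indexed by $V(G_e)$ with all diagonal entries $1$. The matrices $D^*_G = (m_{ij})$ and $D_\mathcal{G} = (d_{ij})$ over $V \times V$ have the entries of $D^*_{G_e}$, respectively of $a_e(D^*_{G_e} - J)$, for $i,j$ in a common block $G_e$ (here $J$ is the all-ones matrix), and otherwise $m_{ij} = m_{iv}m_{vj}$ and $d_{ij} = d_{iv} + m_{iv}d_{vj}$ for any cut-vertex $v$ separating $i$ from $j$. Let $I, J' \subset V$ be such that: (a) $|I| = |J'| \le |V|-3$; (b) for every $u \in I \setminus J'$ there is a unique cut-vertex in $V \setminus (I \cup J')$ that lies on all (undirected) paths from $u$ to $V \setminus I$, and similarly with $I$ and $J'$ exchanged; (c) the induced subgraphs on $V \setminus I$, $V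 \setminus J'$ and $V_\circ := V \setminus (I \cap J')$ are strongly connected. Let $E_\circ$ be the set of those $e \in E$ with $|V(G_e) \cap V_\circ| \ge 2$, i.e. it indexes the traces of the strong blocks of $G$ in the induced subgraph $G[V_\circ]$. For $e \in E_\circ$ let $D^*_e$ be the principal submatrix of $D^*_{G_e}$ on $V(G_e) \cap V_\circ$, let $D_e = a_e(D^*_e - J)$, let $\mathrm{cof}(D_e)$ be the sum of all cofactors of $D_e$, and let $\kappa_e = \det\big(d_{ij} - d_{iv_0} - m_{iv_0}d_{v_0j}\big)_{i,j \in V(G_e) \cap V_\circ \setminus \{v_0\}}$ for an arbitrary $v_0 \in V(G_e) \cap V_\circ$. (If every trace $G[V(G_e) \cap V_\circ]$, $e \in E_\circ$, is connected without cut-vertices, then these traces are exactly the strong blocks of $G[V_\circ]$.) For a $V \times V$ matrix $D$ let $D_{I|J'}$ be the submatrix obtained by removing the rows in $I$ and the columns in $J'$. Then for all $x \in R$, and whatever the choices of $v_0$: (1) If $I = J'$, then $$\det(D_\mathcal{G}+xJ)_{I|J'} = x\prod_{e\in E_\circ}\kappa_e + \sum_{e\in E_\circ}(a_e-x)\,(\kappa_e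 - \mathrm{cof}(D_e))\prod_{f\in E_\circ\setminus\{e\}}\kappa_f .$$ (2) If $|I\Delta J'| = 2$, write $I\setminus J' = \{i_0\}$, $J'\setminus I = \{j_0\}$. Then $i_0$, $j_0$ are pendant in $G[V_\circ]$, with unique neighbors $p(i_0), p(j_0) \in V \setminus (I \cup J')$; the sets $\{p(i_0),i_0\}$ and $\{j_0,p(j_0)\}$ are the vertex sets of the traces of two distinct $e_1,e_2\in E_\circ$; and $$\det(D_\mathcal{G}+xJ)_{I|J'} = \varepsilon \prod_{e\in E_\circ\setminus\{e_1,e_2\}}\kappa_e\cdot a_{e_1}(a_{e_2}-x)(m_{p(i_0),i_0}-1)(m_{j_0,p(j_0)}-1),$$ where $\varepsilon = (-1)^{|\{v\in V_\circ : v<i_0\}|+|\{v\in V_\circ : v<j_0\}|}$; in particular $\varepsilon = (-1)^{|V_\circ|-1}$ if $i_0$ is the first and $j_0$ the last vertex of $V_\circ$. (3) If $|I\Delta J'|>2$, then $\det(D_\mathcal{G}+xJ)_{I|J'} = 0$. -/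

import Mathlib

/-- `G[S]` is strongly connected: any two vertices of `S` are joined by a directed path inside
`S`. -/
def Digraph.StronglyConnectedOn {V : Type*} (G : Digraph V) (S : Finset V) : Prop :=
  ∀ u ∈ S, ∀ v ∈ S, Relation.ReflTransGen (fun a b => a ∈ S ∧ b ∈ S ∧ G.Adj a b) u v

namespace AMDist

open Finset

section Graph

variable {V : Type*}

/-- The underlying undirected simple graph. -/
abbrev und (G : Digraph V) : SimpleGraph V := G.toSimpleGraphInclusive

/-- A cut-vertex is a vertex whose removal disconnects the underlying undirected graph. -/
def IsCutVertex (G : Digraph V) (v : V) : Prop :=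
  ¬ ((und G).induce ({v}ᶜ : Set V)).Preconnected

/-- The subgraph induced on `S` is connected and has no cut-vertex. -/
def Nonseparable (G : Digraph V) (S : Finset V) : Prop :=
  ((und G).induce (S : Set V)).Connected ∧
    ∀ v ∈ S, ((und G).induce ((S : Set V) \ {v})).Preconnected

/-- `B` is the vertex set of a strong block of the induced subgraph `G[W]`, i.e. of a maximal
subgraph without cut-vertices. -/
def IsBlockIn (G : Digraph V) (W B : Finset V) : Prop :=
  Maximal (fun S : Finset V => S ⊆ W ∧ Nonseparable G S) B

/-- The index set `E` of the strong blocks of `G`; a block is recorded by its vertex set. -/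
abbrev StrongBlock [Fintype V] (G : Digraph V) : Type _ :=
  {B : Finset V // IsBlockIn G univ B}

noncomputable instance [Fintype V] (G : Digraph V) : Fintype (StrongBlock G) :=
  Fintype.ofFinite _

/-- `v` is a cut-vertex, different from `i` and `j`, through which one has to pass to get from `i`
to `j`. -/
def CutsBetween (G : Digraph V) (i v j : V) : Prop :=
  IsCutVertex G v ∧ i ≠ v ∧ v ≠ j ∧ (und G).Reachable i j ∧
    ∀ p : (und G).Walk i j, v ∈ p.support

theorem CutsBetween.dist_add_dist_le {G : Digraph V} {i v j : V} (h : CutsBetween G i v j) :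
    (und G).dist i v + (und G).dist v j ≤ (und G).dist i j := by
  classical
  obtain ⟨p, hp⟩ := h.2.2.2.1.exists_walk_length_eq_dist
  have hv := h.2.2.2.2 p
  have h1 := SimpleGraph.dist_le (p.takeUntil v hv)
  have h2 := SimpleGraph.dist_le (p.dropUntil v hv)
  have h3 : (p.takeUntil v hv).length + (p.dropUntil v hv).length = p.length := by
    rw [← SimpleGraph.Walk.length_append, SimpleGraph.Walk.take_spec]
  omega

theorem CutsBetween.reachable {G : Digraph V} {i v j : V} (h : CutsBetween G i v j) :
    (und G).Reachable i v ∧ (und G).Reachable v j := by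
  classical
  obtain ⟨p⟩ := h.2.2.2.1
  have hv := h.2.2.2.2 p
  exact ⟨⟨p.takeUntil v hv⟩, ⟨p.dropUntil v hv⟩⟩

theorem CutsBetween.dist_left_lt {G : Digraph V} {i v j : V} (h : CutsBetween G i v j) :
    (und G).dist i v < (und G).dist i j := by
  have h1 := h.dist_add_dist_le
  have h2 := h.reachable.2.pos_dist_of_ne h.2.2.1
  omega

theorem CutsBetween.dist_right_lt {G : Digraph V} {i v j : V} (h : CutsBetween G i v j) :
    (und G).dist v j < (und G).dist i j := by
  have h1 := h.dist_add_dist_le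
  have h2 := h.reachable.1.pos_dist_of_ne h.2.1
  omega

end Graph

/-- An additive-multiplicative block-datum: for every strong block `e` a scalar `a e` and a square
matrix `m e` over the vertices of `e` with unit diagonal. -/
structure BlockDatum {V : Type*} [Fintype V] (G : Digraph V) (R : Type*) [CommRing R] where
  a : StrongBlock G → R
  m : (e : StrongBlock G) → Matrix {v // v ∈ e.1} {v // v ∈ e.1} R
  m_diag : ∀ e v, m e v v = 1

section Matrices

variable {V : Type*} [Fintype V] {G : Digraph V} {R : Type*} [CommRing R]

open scoped Classical in
/-- The entries `m i j` of the multiplicative distance matrix: those of the block matrix inside a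
strong block, and `m i v * m v j` if `v` is a cut-vertex between `i` and `j`.
(The result does not depend on `v`. The last value is never used when `G` is connected.) -/
noncomputable def BlockDatum.mulDist (𝒢 : BlockDatum G R) (i j : V) : R :=
  if h : ∃ e : StrongBlock G, i ∈ e.1 ∧ j ∈ e.1 then
    𝒢.m h.choose ⟨i, h.choose_spec.1⟩ ⟨j, h.choose_spec.2⟩
  else if h : ∃ v, CutsBetween G i v j then
    𝒢.mulDist i h.choose * 𝒢.mulDist h.choose j
  else 0
termination_by (und G).dist i j
decreasing_by
  · exact h.choose_spec.dist_left_lt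
  · exact h.choose_spec.dist_right_lt

open scoped Classical in
/-- The entries `d i j` of the additive-multiplicative distance matrix: those of `a e (m e - J)`
inside a strong block `e`, and `d i v + m i v * d v j` if `v` is a cut-vertex between `i` and `j`.
(The result does not depend on `v`. The last value is never used when `G` is connected.) -/
noncomputable def BlockDatum.addDist (𝒢 : BlockDatum G R) (i j : V) : R :=
  if h : ∃ e : StrongBlock G, i ∈ e.1 ∧ j ∈ e.1 then
    𝒢.a h.choose * (𝒢.m h.choose ⟨i, h.choose_spec.1⟩ ⟨j, h.choose_spec.2⟩ - 1)
  else if h : ∃ v, CutsBetween G i v j then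
    𝒢.addDist i h.choose + 𝒢.mulDist i h.choose * 𝒢.addDist h.choose j
  else 0
termination_by (und G).dist i j
decreasing_by
  · exact h.choose_spec.dist_left_lt
  · exact h.choose_spec.dist_right_lt

/-- The matrix `D_𝒢 + x J`. -/
noncomputable def BlockDatum.distMatrixAdd (𝒢 : BlockDatum G R) (x : R) : Matrix V V R :=
  Matrix.of fun i j => 𝒢.addDist i j + x

variable [DecidableEq V]

/-- The indices of those strong blocks of `G` that leave a nontrivial trace (at least two vertices)
in the induced subgraph on `W`. -/
abbrev TraceBlock (G : Digraph V) (W : Finset V) : Type _ :=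
  {e : StrongBlock G // 2 ≤ #(e.1 ∩ W)}

/-- The vertex set of the trace of the block in the induced subgraph on `W`. -/
abbrev TraceBlock.verts {W : Finset V} (e : TraceBlock G W) : Finset V := e.1.1 ∩ W

/-- The additive weight of a trace block. -/
def BlockDatum.traceWeight (𝒢 : BlockDatum G R) {W : Finset V} (e : TraceBlock G W) : R := 𝒢.a e.1

/-- The multiplicative distance matrix of a trace block, a principal submatrix of that of the
block. -/
def BlockDatum.traceMul (𝒢 : BlockDatum G R) {W : Finset V} (e : TraceBlock G W) :
    Matrix {v // v ∈ e.verts} {v // v ∈ e.verts} R :=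
  Matrix.of fun i j => 𝒢.m e.1 ⟨i.1, (mem_inter.1 i.2).1⟩ ⟨j.1, (mem_inter.1 j.2).1⟩

/-- The additive-multiplicative distance matrix `a e (m e - J)` of a trace block. -/
def BlockDatum.traceDist (𝒢 : BlockDatum G R) {W : Finset V} (e : TraceBlock G W) :
    Matrix {v // v ∈ e.verts} {v // v ∈ e.verts} R :=
  Matrix.of fun i j => 𝒢.traceWeight e * (𝒢.traceMul e i j - 1)

end Matrices

section Invariants

variable {R : Type*} [CommRing R]

/-- The cofactor-sum of a square matrix. -/
def cofSum {ι : Type*} [Fintype ι] [DecidableEq ι] (A : Matrix ι ι R) : R :=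
  ∑ i, ∑ j, A.adjugate i j

/-- The invariant `κ(D, v₀) = det (D| - u eᵀ - m(·, v₀) wᵀ)`, where `D|` is `D` without the row and
the column of `v₀`, where `u` and `wᵀ` are the column and the row of `v₀` in `D`, and `M` is the
multiplicative distance matrix. -/
def kappa {ι : Type*} [Fintype ι] [DecidableEq ι] (D M : Matrix ι ι R) (v₀ : ι) : R :=
  Matrix.det (Matrix.of fun i j : {i : ι // i ≠ v₀} =>
    D i j - D i v₀ - M i v₀ * D v₀ j)

/-- The determinant of the matrix obtained from `A` by deleting the rows in `I` and the columns in
`J`, the remaining rows and columns being kept in increasing order. -/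
def minorDet {V : Type*} [Fintype V] [LinearOrder V] (A : Matrix V V R) (I J : Finset V)
    (h : #I = #J) : R :=
  Matrix.det (A.submatrix (Iᶜ.orderEmbOfFin rfl)
    (Jᶜ.orderEmbOfFin (show #Jᶜ = #Iᶜ by rw [card_compl, card_compl, h])))

end Invariants

section Invariants2

variable {V : Type*} [Fintype V] [DecidableEq V] {G : Digraph V} {R : Type*} [CommRing R]

/-- The invariant `κ` of a trace block with respect to one of its vertices. -/
def BlockDatum.traceKappa (𝒢 : BlockDatum G R) {W : Finset V} (e : TraceBlock G W)
    (v₀ : {v // v ∈ e.verts}) : R :=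
  kappa (𝒢.traceDist e) (𝒢.traceMul e) v₀

/-- Every vertex of `I \ J` is connected to the complement of `I` through a unique cut-vertex
outside `I ∪ J`: there is exactly one cut-vertex outside `I ∪ J` that lies on all paths of the
underlying undirected graph from the given vertex to the complement of `I`. -/
def ConnectedThroughUniqueCutVertex (G : Digraph V) (I J : Finset V) : Prop :=
  ∀ u ∈ I \ J, ∃! v, v ∉ I ∪ J ∧ IsCutVertex G v ∧
    ∀ t ∉ I, ∀ p : (und G).Walk u t, v ∈ p.support

end Invariants2

end AMDist

/-!
Blocks of a connected graph are the maximal sets of pairwise inseparable vertices, where two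
vertices are inseparable if no third vertex separates them. This description (`isBlockIn_univ_iff`)
supplies the graph theory: two vertices outside a common block have a cut-vertex between them, the
defining recursion of the distance matrices holds for every such cut-vertex (`dist_of_cutsBetween`),
and a set `W` of vertices with connected induced subgraph that lies in no single block is a union of
two smaller such sets `A`, `B` that meet in one vertex `v`, which separates them in the whole graph
(`exists_split`).

Fix `v ∈ W` and put `K i j = d i j - d i v - m i v * d v j`. Subtracting `m i v` times the row of
`v` from the row of every other `i`, and then the column of `v` from the other columns, turns `d + x
J` on `W` into the matrix `K` bordered by a row and a column, with corner `x`. If `W = A ∪ B` as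
above, then `K` is block diagonal. Hence `κ W = det K` is multiplicative, and `det (d + x J) - x κ`
obeys the product rule (`detOn_bordered_union`). Inside one block `κ` is a Schur complement of the
multiplicative distance matrix and does not depend on the base vertex (`kappaOn_block`), and
`kappaOn_union_of_ne` carries this independence over to unions. Induction on `W` down to subsets of
a single block gives the formula for `I = J` (`kappaOn_and_detOn`). Traces with at most one vertex
have `κ = 1` and contribute nothing to the sum, so the induction can run over all blocks of `G`.

If `I ≠ J`, a vertex `q` of `J \ I` reaches all columns through a single cut-vertex `w`, so
subtracting `m q w` times the row of `w` leaves a multiple of the all-ones row. Two such rows give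
determinant zero (`minorDet_eq_zero`). If there is only one, the dual operation makes the column of
`i₀` proportional to the column `m · p` of its neighbor `p`, and the bordered determinant that
remains is `κ` with base vertex `p` of the set without `i₀` and `j₀` (`detOn_cofactor`,
`minorDet_of_pendant`).
-/

namespace AMDist

open Finset

/-! ### Connectivity inside a set of vertices -/

section Connectivity

variable {V : Type*} {H : SimpleGraph V} {X Y : Set V} {a b c u v : V}

/-- `ConnOn H X a b`: the vertices `a` and `b` are equal or joined by a walk of `H` all of whose
vertices lie in `X`. -/
def ConnOn (H : SimpleGraph V) (X : Set V) : V → V → Prop :=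
  Relation.ReflTransGen fun x y => x ∈ X ∧ y ∈ X ∧ H.Adj x y

theorem ConnOn.refl (a : V) : ConnOn H X a a := Relation.ReflTransGen.refl

theorem ConnOn.trans (h : ConnOn H X a b) (h' : ConnOn H X b c) : ConnOn H X a c :=
  Relation.ReflTransGen.trans h h'

theorem ConnOn.symm (h : ConnOn H X a b) : ConnOn H X b a := by
  induction h with
  | refl => exact .refl _
  | tail _ h ih => exact .head ⟨h.2.1, h.1, h.2.2.symm⟩ ih

theorem ConnOn.mono (hXY : X ⊆ Y) (h : ConnOn H X a b) : ConnOn H Y a b :=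
  Relation.ReflTransGen.mono (fun _ _ h => ⟨hXY h.1, hXY h.2.1, h.2.2⟩) _ _ h

theorem ConnOn.of_adj (ha : a ∈ X) (hb : b ∈ X) (h : H.Adj a b) : ConnOn H X a b :=
  .single ⟨ha, hb, h⟩

theorem ConnOn.exists_adj (h : ConnOn H X a b) (hab : a ≠ b) : ∃ c ∈ X, H.Adj a c := by
  induction h using Relation.ReflTransGen.head_induction_on with
  | refl => exact absurd rfl hab
  | head h _ _ => exact ⟨_, h.2.1, h.2.2⟩

theorem reachable_induce_iff (ha : a ∈ X) (hb : b ∈ X) :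
    (H.induce X).Reachable ⟨a, ha⟩ ⟨b, hb⟩ ↔ ConnOn H X a b := by
  constructor
  · intro h
    rw [SimpleGraph.reachable_iff_reflTransGen] at h
    exact Relation.ReflTransGen.lift (fun v : X => (v : V))
      (fun x y hxy => ⟨x.2, y.2, hxy⟩) _ _ h
  · intro h
    induction h with
    | refl => exact .refl _
    | tail _ h ih =>
      have h2 : (H.induce X).Adj ⟨_, h.1⟩ ⟨_, h.2.1⟩ := h.2.2
      exact (ih h.1).trans h2.reachable

theorem preconnected_induce_iff :
    (H.induce X).Preconnected ↔ ∀ a ∈ X, ∀ b ∈ X, ConnOn H X a b :=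
  ⟨fun h _ ha _ hb => (reachable_induce_iff ha hb).1 (h _ _),
    fun h a b => (reachable_induce_iff a.2 b.2).2 (h a a.2 b b.2)⟩

/-- A walk avoids `v` exactly if it is a walk in the complement of `v`. -/
theorem exists_walk_notMem_iff (hav : a ≠ v) :
    (∃ p : H.Walk a b, v ∉ p.support) ↔ ConnOn H {v}ᶜ a b := by
  constructor
  · rintro ⟨p, hp⟩
    induction p with
    | nil => exact .refl _
    | cons h p ih =>
      simp only [SimpleGraph.Walk.support_cons, List.mem_cons, not_or] at hp
      have hne : _ ≠ v := fun h => hp.2 (h ▸ p.start_mem_support)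
      exact .head ⟨hav, hne, h⟩ (ih hne hp.2)
  · intro h
    induction h using Relation.ReflTransGen.head_induction_on with
    | refl => exact ⟨.nil, by simpa using hav.symm⟩
    | head h _ ih =>
      obtain ⟨p, hp⟩ := ih h.2.1
      exact ⟨.cons h.2.2 p, by simp [hp, hav.symm]⟩

/-- Removing a vertex with a single neighbor does not destroy connectivity. -/
theorem ConnOn.diff_pendant (hpend : ∀ z ∈ X, H.Adj u z → z = c) (h : ConnOn H X a b)
    (ha : a ≠ u) (hb : b ≠ u) : ConnOn H (X \ {u}) a b := by
  have key : (b ≠ u → ConnOn H (X \ {u}) a b) ∧ (b = u → ConnOn H (X \ {u}) a c) := by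
    clear hb
    induction h with
    | refl => exact ⟨fun _ => .refl _, fun h => absurd h ha⟩
    | @tail y z _ h ih =>
      by_cases hy : y = u
      · subst hy
        obtain rfl := hpend z h.2.1 h.2.2
        exact ⟨fun _ => ih.2 rfl, fun hz => absurd hz h.2.2.ne'⟩
      · refine ⟨fun hz => (ih.1 hy).tail ⟨⟨h.1, hy⟩, ⟨h.2.1, hz⟩, h.2.2⟩, fun hz => ?_⟩
        subst hz
        obtain rfl := hpend y h.1 h.2.2.symm
        exact ih.1 hy
  exact key.1 hb

/-- A connection of `a` to `v` can be chosen inside the component of `a` in the complement of `v`,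
extended by `v`. -/
theorem ConnOn.within_component (h : ConnOn H X a v) :
    ConnOn H {z | z ∈ X ∧ (z = v ∨ ConnOn H {v}ᶜ a z)} a v := by
  induction h using Relation.ReflTransGen.head_induction_on with
  | refl => exact .refl _
  | @head x y h _ ih =>
    by_cases hx : x = v
    · subst hx; exact .refl _
    by_cases hy : y = v
    · subst hy
      exact .of_adj ⟨h.1, Or.inr (.refl _)⟩ ⟨h.2.1, Or.inl rfl⟩ h.2.2
    have hxy : ConnOn H {v}ᶜ x y := .of_adj hx hy h.2.2
    have : ConnOn H {z | z ∈ X ∧ (z = v ∨ ConnOn H {v}ᶜ x z)} y v :=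
      ih.mono fun z hz => ⟨hz.1, hz.2.imp id fun h => hxy.trans h⟩
    exact .head ⟨⟨h.1, Or.inr (.refl _)⟩, ⟨h.2.1, Or.inr hxy⟩, h.2.2⟩ this

/-- Of two vertices on the way from `a` to `b`, one is reached before the other. -/
theorem ConnOn.first_of_two (h : ConnOn H X a u) (ha : a ≠ u) (ha' : a ≠ v) (huv : u ≠ v) :
    ConnOn H {v}ᶜ a u ∨ ConnOn H {u}ᶜ a v := by
  by_cases hv : ConnOn H {v}ᶜ a u
  · exact Or.inl hv
  refine Or.inr ?_
  have key : ∀ y, ConnOn H X a y →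
      ConnOn H ({u, v} : Set V)ᶜ a y ∧ y ≠ u ∧ y ≠ v ∨ ConnOn H {u}ᶜ a v := by
    intro y hy
    induction hy with
    | refl => exact Or.inl ⟨.refl _, ha, ha'⟩
    | @tail y z _ hyz ih =>
      rcases ih with ⟨h1, hyu, hyv⟩ | ih
      · by_cases hzv : z = v
        · subst hzv
          exact Or.inr ((h1.mono (by intro t; simp; tauto)).tail ⟨hyu, huv.symm, hyz.2.2⟩)
        by_cases hzu : z = u
        · subst hzu
          exact absurd ((h1.mono (by intro t; simp)).tail ⟨hyv, hzv, hyz.2.2⟩) hv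
        · exact Or.inl ⟨h1.tail ⟨by simp [hyu, hyv], by simp [hzu, hzv], hyz.2.2⟩, hzu, hzv⟩
      · exact Or.inr ih
  rcases key u h with ⟨_, h, _⟩ | h
  · exact absurd rfl h
  · exact h

end Connectivity

/-! ### Blocks as maximal sets of pairwise inseparable vertices -/

section Inseparable

variable {V : Type*} {H : SimpleGraph V} {S T : Finset V} {a b c x : V}

/-- No third vertex separates `a` from `b`. -/
def Insep (H : SimpleGraph V) (a b : V) : Prop :=
  ∀ v, v ≠ a → v ≠ b → ConnOn H {v}ᶜ a b

theorem Insep.symm (h : Insep H a b) : Insep H b a := fun v h1 h2 => (h v h2 h1).symm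

theorem Insep.refl (a : V) : Insep H a a := fun _ _ _ => .refl _

theorem Insep.of_adj (h : H.Adj a b) : Insep H a b :=
  fun _ h1 h2 => .of_adj h1.symm h2.symm h

/-- The vertices of `S` are pairwise inseparable. -/
def InsepSet (H : SimpleGraph V) (S : Finset V) : Prop := ∀ a ∈ S, ∀ b ∈ S, Insep H a b

theorem InsepSet.exists_maximal [Finite V] (h : InsepSet H S) :
    ∃ T, S ⊆ T ∧ Maximal (InsepSet H) T :=
  Finite.exists_le_maximal h

theorem insepSet_pair [DecidableEq V] (h : Insep H a b) : InsepSet H {a, b} := by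
  intro x hx y hy
  simp only [mem_insert, mem_singleton] at hx hy
  rcases hx with rfl | rfl <;> rcases hy with rfl | rfl
  exacts [.refl _, h, h.symm, .refl _]

/-- A vertex outside a maximal set of pairwise inseparable vertices is separated from that set by
a single vertex. -/
theorem exists_gate (hS : Maximal (InsepSet H) S) (hx : x ∉ S) :
    ∃ c, c ≠ x ∧ ∀ s ∈ S, s ≠ c → ¬ ConnOn H {c}ᶜ x s := by
  classical
  have h1 : ¬ ∀ s ∈ S, Insep H x s := by
    intro h
    refine hx (hS.2 (y := insert x S) ?_ (subset_insert x S) (mem_insert_self x S))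
    intro a ha b hb
    rcases mem_insert.1 ha with rfl | ha' <;> rcases mem_insert.1 hb with rfl | hb'
    exacts [.refl _, h b hb', (h a ha').symm, hS.1 a ha' b hb']
  simp only [Insep, not_forall] at h1
  obtain ⟨s, hs, c, hcx, hcs, hc⟩ := h1
  refine ⟨c, hcx, fun t ht htc htx => hc ?_⟩
  exact htx.trans (hS.1 t ht s hs c htc.symm hcs)

theorem maximal_insepSet_eq (hS : Maximal (InsepSet H) S) (hT : Maximal (InsepSet H) T)
    (hab : a ≠ b) (haS : a ∈ S) (hbS : b ∈ S) (haT : a ∈ T) (hbT : b ∈ T) : S = T := by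
  have key : ∀ {S T : Finset V}, Maximal (InsepSet H) S → Maximal (InsepSet H) T →
      a ∈ S → b ∈ S → a ∈ T → b ∈ T → S ⊆ T := by
    intro S T hS hT haS hbS haT hbT x hx
    by_contra hxT
    obtain ⟨c, hcx, hc⟩ := exists_gate hT hxT
    by_cases hca : a = c
    · have hcb : b ≠ c := fun h => hab (hca.trans h.symm)
      exact hc b hbT hcb (hS.1 x hx b hbS c hcx hcb.symm)
    · exact hc a haT hca (hS.1 x hx a haS c hcx (Ne.symm hca))
  exact (key hS hT haS hbS haT hbT).antisymm (key hT hS haT hbT haS hbS)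

/-- A walk between two vertices of a block can be shortcut to a walk inside the block: an excursion
returns through the vertex at which it left. -/
theorem ConnOn.inter_block {X : Set V} (hS : Maximal (InsepSet H) S) (h : ConnOn H X a b)
    (ha : a ∈ S) (hb : b ∈ S) : ConnOn H (S ∩ X) a b := by
  have key : (b ∈ S → ConnOn H (S ∩ X) a b) ∧
      (b ∉ S → ∃ p ∈ S, ConnOn H (S ∩ X) a p ∧ ∃ x ∉ S, H.Adj x p ∧ ConnOn H (Sᶜ : Set V) x b) := by
    clear hb
    induction h with
    | refl => exact ⟨fun _ => .refl _, fun h => absurd ha h⟩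
    | @tail y z _ h ih =>
      by_cases hy : y ∈ S
      · refine ⟨fun hz => (ih.1 hy).tail ⟨⟨hy, h.1⟩, ⟨hz, h.2.1⟩, h.2.2⟩, fun hz => ?_⟩
        exact ⟨y, hy, ih.1 hy, z, hz, h.2.2.symm, .refl _⟩
      · obtain ⟨p, hp, hap, x, hx, hxp, hxy⟩ := ih.2 hy
        refine ⟨fun hz => ?_, fun hz => ⟨p, hp, hap, x, hx, hxp, hxy.tail ⟨hy, hz, h.2.2⟩⟩⟩
        obtain ⟨c, hcx, hc⟩ := exists_gate hS hx
        have hpc : p = c := by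
          by_contra hpc
          exact hc p hp hpc (.of_adj hcx.symm hpc hxp)
        subst hpc
        by_cases hzp : z = p
        · rwa [hzp]
        refine absurd ?_ (hc z hz hzp)
        have hsub : (Sᶜ : Set V) ⊆ {p}ᶜ := by
          intro t ht htp
          rw [Set.mem_singleton_iff] at htp
          exact ht (htp ▸ hp)
        exact (hxy.mono hsub).tail ⟨fun h => hy (h ▸ hp), hzp, h.2.2⟩
  exact key.1 hb

/-- A connected set that lies in no block is the union of two smaller connected sets that share a
single vertex, which separates them in the whole graph. -/
theorem exists_split [Finite V] [DecidableEq V] {W : Finset V}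
    (hW : ∀ a ∈ W, ∀ b ∈ W, ConnOn H W a b)
    (hno : ∀ S, Maximal (InsepSet H) S → ¬ W ⊆ S) :
    ∃ (v : V) (A B : Finset V), A ∪ B = W ∧ A ∩ B = {v} ∧ #A < #W ∧ #B < #W ∧
      (∀ a ∈ A, ∀ b ∈ A, ConnOn H A a b) ∧ (∀ a ∈ B, ∀ b ∈ B, ConnOn H B a b) ∧
      ∀ a ∈ A, ∀ b ∈ B, a ≠ v → b ≠ v → ¬ ConnOn H {v}ᶜ a b := by
  classical
  have h1 : ¬ InsepSet H W := fun h => by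
    obtain ⟨T, hT, hT'⟩ := h.exists_maximal
    exact hno T hT' hT
  simp only [InsepSet, Insep, not_forall] at h1
  obtain ⟨i, hi, j, hj, v, hvi, hvj, hv⟩ := h1
  have hvW : v ∈ W := by
    by_contra hvW
    refine hv ((hW i hi j hj).mono fun t ht htv => hvW ?_)
    rw [Set.mem_singleton_iff] at htv
    exact htv ▸ ht
  have conn : ∀ A : Finset V, (∀ x ∈ A, x ∈ W) →
      (∀ x ∈ A, x ≠ v → ∀ z ∈ W, ConnOn H {v}ᶜ x z → z ∈ A) → v ∈ A →
      ∀ a ∈ A, ∀ b ∈ A, ConnOn H A a b := by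
    intro A hAW hA hvA
    have : ∀ a ∈ A, ConnOn H A a v := by
      intro a ha
      by_cases hav : a = v
      · subst hav; exact .refl _
      refine (hW a (hAW a ha) v hvW).within_component.mono ?_
      rintro z ⟨hz, rfl | hz'⟩
      · exact hvA
      · exact hA a ha hav z hz hz'
    exact fun a ha b hb => (this a ha).trans (this b hb).symm
  refine ⟨v, W.filter (fun z => z = v ∨ ConnOn H {v}ᶜ i z),
    W.filter (fun z => z = v ∨ ¬ ConnOn H {v}ᶜ i z), ?_, ?_, ?_, ?_, ?_, ?_, ?_⟩
  · ext z; simp only [mem_union, mem_filter]; tauto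
  · ext z
    simp only [mem_inter, mem_filter, mem_singleton]
    constructor
    · tauto
    · rintro rfl; tauto
  · refine card_lt_card (filter_ssubset.2 ⟨j, hj, ?_⟩)
    rintro (h | h)
    · exact hvj h.symm
    · exact hv h
  · refine card_lt_card (filter_ssubset.2 ⟨i, hi, ?_⟩)
    rintro (h | h)
    · exact hvi h.symm
    · exact h (.refl _)
  · refine conn _ (fun x hx => (mem_filter.1 hx).1) ?_ (mem_filter.2 ⟨hvW, Or.inl rfl⟩)
    intro x hx hxv z hz hxz
    rcases (mem_filter.1 hx).2 with h | h
    · exact absurd h hxv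
    · exact mem_filter.2 ⟨hz, Or.inr (h.trans hxz)⟩
  · refine conn _ (fun x hx => (mem_filter.1 hx).1) ?_ (mem_filter.2 ⟨hvW, Or.inl rfl⟩)
    intro x hx hxv z hz hxz
    rcases (mem_filter.1 hx).2 with h | h
    · exact absurd h hxv
    · exact mem_filter.2 ⟨hz, Or.inr fun h' => h (h'.trans hxz.symm)⟩
  · intro a ha b hb hav hbv hab
    rcases (mem_filter.1 ha).2 with h | h
    · exact hav h
    rcases (mem_filter.1 hb).2 with h' | h'
    · exact hbv h'
    · exact h' (h.trans hab)

end Inseparable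

section Blocks

variable {V : Type*} {G : Digraph V} {W S : Finset V}

theorem Nonseparable.insepSet (h : Nonseparable G S) : InsepSet (und G) S := by
  intro a ha b hb v hva hvb
  by_cases hv : v ∈ S
  · refine (preconnected_induce_iff.1 (h.2 v hv) a ⟨ha, hva.symm⟩ b ⟨hb, hvb.symm⟩).mono ?_
    exact fun t ht => ht.2
  · refine (preconnected_induce_iff.1 h.1.preconnected a ha b hb).mono ?_
    rintro t ht rfl
    exact hv ht

theorem nonseparable_of_maximal (hG : ∀ a b, ConnOn (und G) Set.univ a b)
    (hS : Maximal (InsepSet (und G)) S) (hne : S.Nonempty) : Nonseparable G S := by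
  constructor
  · obtain ⟨s, hs⟩ := hne
    have : Nonempty (S : Set V) := ⟨⟨s, hs⟩⟩
    refine ⟨preconnected_induce_iff.2 fun a ha b hb => ?_⟩
    exact ((hG a b).inter_block hS ha hb).mono (by simp)
  · intro v hv
    refine preconnected_induce_iff.2 fun a ha b hb => ?_
    have h := hS.1 a ha.1 b hb.1 v (fun h => ha.2 h.symm) (fun h => hb.2 h.symm)
    exact h.inter_block hS ha.1 hb.1

theorem nonseparable_pair [DecidableEq V] {a b : V} (h : (und G).Adj a b) :
    Nonseparable G {a, b} := by
  constructor
  · have : Nonempty ((({a, b} : Finset V)) : Set V) := ⟨⟨a, by simp⟩⟩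
    refine ⟨preconnected_induce_iff.2 fun x hx y hy => ?_⟩
    have hab : ConnOn (und G) (({a, b} : Finset V) : Set V) a b :=
      .of_adj (by simp) (by simp) h
    simp only [coe_insert, coe_singleton, Set.mem_insert_iff, Set.mem_singleton_iff] at hx hy
    rcases hx with rfl | rfl <;> rcases hy with rfl | rfl
    exacts [.refl _, hab, hab.symm, .refl _]
  · intro v hv
    refine preconnected_induce_iff.2 fun x hx y hy => ?_
    simp only [coe_insert, coe_singleton, Set.mem_insert_iff, Set.mem_singleton_iff,
      Set.mem_sdiff, mem_insert, mem_singleton] at hx hy hv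
    have : x = y := by grind
    rw [this]
    exact .refl _

/-- The blocks of a connected graph are the maximal sets of pairwise inseparable vertices. -/
theorem isBlockIn_univ_iff [Fintype V] [Nonempty V] (hG : ∀ a b, ConnOn (und G) Set.univ a b) :
    IsBlockIn G univ S ↔ Maximal (InsepSet (und G)) S := by
  have hne : ∀ T : Finset V, Maximal (InsepSet (und G)) T → T.Nonempty := by
    intro T hT
    by_contra h
    rw [not_nonempty_iff_eq_empty] at h
    subst h
    obtain ⟨v⟩ := ‹Nonempty V›
    have := hT.2 (y := {v}) (by
      intro a ha b hb
      rw [mem_singleton] at ha hb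
      rw [ha, hb]; exact .refl _) (empty_subset _)
    simpa using this (mem_singleton_self v)
  constructor
  · intro h
    obtain ⟨T, hST, hT⟩ := h.1.2.insepSet.exists_maximal
    have hTS := h.2 ⟨subset_univ T, nonseparable_of_maximal hG hT (hne T hT)⟩ hST
    rwa [hST.antisymm hTS]
  · intro h
    refine ⟨⟨subset_univ S, nonseparable_of_maximal hG h (hne S h)⟩, ?_⟩
    rintro T ⟨-, hT⟩ hST
    exact h.2 hT.insepSet hST

end Blocks

/-! ### The distance matrices in terms of separation -/

section Distances

variable {V : Type*} {G : Digraph V} {R : Type*} [CommRing R] {i j v w : V}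

theorem cutsBetween_iff (hG : ∀ a b, ConnOn (und G) Set.univ a b) :
    CutsBetween G i v j ↔ i ≠ v ∧ v ≠ j ∧ ¬ ConnOn (und G) {v}ᶜ i j := by
  constructor
  · rintro ⟨-, h1, h2, -, h3⟩
    refine ⟨h1, h2, fun h => ?_⟩
    obtain ⟨p, hp⟩ := (exists_walk_notMem_iff h1).2 h
    exact hp (h3 p)
  · rintro ⟨h1, h2, h3⟩
    refine ⟨fun h => h3 (preconnected_induce_iff.1 h i h1 j h2.symm), h1, h2, ?_, fun p => ?_⟩
    · rw [SimpleGraph.reachable_iff_reflTransGen]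
      exact Relation.ReflTransGen.mono (fun _ _ h => h.2.2) _ _ (hG i j)
    · by_contra hp
      exact h3 ((exists_walk_notMem_iff h1).1 ⟨p, hp⟩)

/-- Two cut-vertices between `i` and `j` are passed in a definite order. -/
theorem CutsBetween.order (hG : ∀ a b, ConnOn (und G) Set.univ a b)
    (hv : CutsBetween G i v j) (hw : CutsBetween G i w j) (hvw : v ≠ w) :
    (CutsBetween G i w v ∧ CutsBetween G w v j) ∨
      (CutsBetween G i v w ∧ CutsBetween G v w j) := by
  rw [cutsBetween_iff hG] at hv hw
  simp only [cutsBetween_iff hG]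
  obtain ⟨hiv, hvj, hv⟩ := hv
  obtain ⟨hiw, hwj, hw⟩ := hw
  have key : ∀ {v w : V}, i ≠ v → v ≠ j → ¬ ConnOn (und G) {v}ᶜ i j → i ≠ w → w ≠ j →
      ¬ ConnOn (und G) {w}ᶜ i j → v ≠ w → ConnOn (und G) {v}ᶜ i w →
      (i ≠ w ∧ w ≠ v ∧ ¬ ConnOn (und G) {w}ᶜ i v) ∧ (w ≠ v ∧ v ≠ j ∧ ¬ ConnOn (und G) {v}ᶜ w j) := by
    intro v w hiv hvj hv hiw hwj hw hvw h
    refine ⟨⟨hiw, hvw.symm, fun h' => ?_⟩, hvw.symm, hvj, fun h' => hv (h.trans h')⟩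
    rcases (hG j v).first_of_two hvj.symm hwj.symm hvw with h2 | h2
    · exact hw (h'.trans h2.symm)
    · exact hv (h.trans h2.symm)
  rcases (hG i w).first_of_two hiw hiv hvw.symm with h | h
  · exact Or.inl (key hiv hvj hv hiw hwj hw hvw h)
  · exact Or.inr (key hiw hwj hw hiv hvj hv hvw.symm h)

variable [Fintype V] (𝒢 : BlockDatum G R)

section

variable [Nonempty V] (hG : ∀ a b, ConnOn (und G) Set.univ a b)
include hG

theorem exists_strongBlock {S : Finset V} (h : InsepSet (und G) S) :
    ∃ e : StrongBlock G, S ⊆ e.1 := by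
  obtain ⟨T, hT, hT'⟩ := h.exists_maximal
  exact ⟨⟨T, (isBlockIn_univ_iff hG).2 hT'⟩, hT⟩

theorem StrongBlock.maximal (e : StrongBlock G) : Maximal (InsepSet (und G)) e.1 :=
  (isBlockIn_univ_iff hG).1 e.2

theorem strongBlock_eq {e f : StrongBlock G} (hij : i ≠ j) (hi : i ∈ e.1) (hj : j ∈ e.1)
    (hi' : i ∈ f.1) (hj' : j ∈ f.1) : e = f :=
  Subtype.ext (maximal_insepSet_eq (e.maximal hG) (f.maximal hG) hij hi hj hi' hj')

theorem CutsBetween.not_common_block (h : CutsBetween G i v j) :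
    ¬ ∃ e : StrongBlock G, i ∈ e.1 ∧ j ∈ e.1 := by
  rintro ⟨e, hi, hj⟩
  obtain ⟨h1, h2, h3⟩ := (cutsBetween_iff hG).1 h
  exact h3 ((e.maximal hG).1 i hi j hj v h1.symm h2)

theorem mulDist_block (e : StrongBlock G) (hi : i ∈ e.1) (hj : j ∈ e.1) :
    𝒢.mulDist i j = 𝒢.m e ⟨i, hi⟩ ⟨j, hj⟩ := by
  have h : ∃ e : StrongBlock G, i ∈ e.1 ∧ j ∈ e.1 := ⟨e, hi, hj⟩
  rw [BlockDatum.mulDist, dif_pos h]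
  by_cases hij : i = j
  · subst hij
    rw [𝒢.m_diag, 𝒢.m_diag]
  · have key : ∀ (f : StrongBlock G) (h1 : i ∈ f.1) (h2 : j ∈ f.1),
        𝒢.m f ⟨i, h1⟩ ⟨j, h2⟩ = 𝒢.m e ⟨i, hi⟩ ⟨j, hj⟩ := by
      intro f h1 h2
      obtain rfl := strongBlock_eq hG hij hi hj h1 h2
      rfl
    exact key _ _ _

theorem addDist_block (e : StrongBlock G) (hi : i ∈ e.1) (hj : j ∈ e.1) :
    𝒢.addDist i j = 𝒢.a e * (𝒢.mulDist i j - 1) := by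
  have h : ∃ e : StrongBlock G, i ∈ e.1 ∧ j ∈ e.1 := ⟨e, hi, hj⟩
  rw [mulDist_block 𝒢 hG e hi hj, BlockDatum.addDist, dif_pos h]
  by_cases hij : i = j
  · subst hij
    rw [𝒢.m_diag, 𝒢.m_diag]; simp
  · have key : ∀ (f : StrongBlock G) (h1 : i ∈ f.1) (h2 : j ∈ f.1),
        𝒢.a f * (𝒢.m f ⟨i, h1⟩ ⟨j, h2⟩ - 1) = 𝒢.a e * (𝒢.m e ⟨i, hi⟩ ⟨j, hj⟩ - 1) := by
      intro f h1 h2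
      obtain rfl := strongBlock_eq hG hij hi hj h1 h2
      rfl
    exact key _ _ _

theorem mulDist_self (i : V) : 𝒢.mulDist i i = 1 := by
  obtain ⟨e, he⟩ := exists_strongBlock hG (S := {i}) (by
    intro a ha b hb
    rw [mem_singleton] at ha hb
    rw [ha, hb]; exact .refl _)
  have hi := he (mem_singleton_self i)
  rw [mulDist_block 𝒢 hG e hi hi, 𝒢.m_diag]

theorem addDist_self (i : V) : 𝒢.addDist i i = 0 := by
  obtain ⟨e, he⟩ := exists_strongBlock hG (S := {i}) (by
    intro a ha b hb
    rw [mem_singleton] at ha hb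
    rw [ha, hb]; exact .refl _)
  have hi := he (mem_singleton_self i)
  rw [addDist_block 𝒢 hG e hi hi, mulDist_self 𝒢 hG, sub_self, mul_zero]

/-- The recursion for the distance matrices holds for every cut-vertex between `i` and `j`, not only
for the chosen one. -/
theorem dist_of_cutsBetween (h : CutsBetween G i v j) :
    𝒢.mulDist i j = 𝒢.mulDist i v * 𝒢.mulDist v j ∧
      𝒢.addDist i j = 𝒢.addDist i v + 𝒢.mulDist i v * 𝒢.addDist v j := by
  classical
  induction hn : (und G).dist i j using Nat.strong_induction_on generalizing i j v with
  | _ n ih =>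
    subst hn
    have hb := h.not_common_block hG
    have hex : ∃ v, CutsBetween G i v j := ⟨v, h⟩
    have hm : 𝒢.mulDist i j = 𝒢.mulDist i hex.choose * 𝒢.mulDist hex.choose j := by
      rw [BlockDatum.mulDist, dif_neg hb, dif_pos hex]
    have hd : 𝒢.addDist i j =
        𝒢.addDist i hex.choose + 𝒢.mulDist i hex.choose * 𝒢.addDist hex.choose j := by
      rw [BlockDatum.addDist, dif_neg hb, dif_pos hex]
    have hw := hex.choose_spec
    generalize hex.choose = w at hm hd hw
    by_cases hvw : v = w
    · subst hvw; exact ⟨hm, hd⟩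
    rcases h.order hG hw hvw with ⟨h1, h2⟩ | ⟨h1, h2⟩
    · obtain ⟨m1, d1⟩ := ih _ h.dist_left_lt h1 rfl
      obtain ⟨m2, d2⟩ := ih _ hw.dist_right_lt h2 rfl
      rw [hm, hd, m2, d2, m1, d1]
      constructor <;> ring
    · obtain ⟨m1, d1⟩ := ih _ hw.dist_left_lt h1 rfl
      obtain ⟨m2, d2⟩ := ih _ h.dist_right_lt h2 rfl
      rw [hm, hd, m2, d2, m1, d1]
      constructor <;> ring

theorem mulDist_of_separates (h : i ≠ v → v ≠ j → ¬ ConnOn (und G) {v}ᶜ i j) :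
    𝒢.mulDist i j = 𝒢.mulDist i v * 𝒢.mulDist v j := by
  by_cases h1 : i = v
  · subst h1; rw [mulDist_self 𝒢 hG, one_mul]
  by_cases h2 : v = j
  · subst h2; rw [mulDist_self 𝒢 hG, mul_one]
  exact (dist_of_cutsBetween 𝒢 hG ((cutsBetween_iff hG).2 ⟨h1, h2, h h1 h2⟩)).1

theorem addDist_of_separates (h : i ≠ v → v ≠ j → ¬ ConnOn (und G) {v}ᶜ i j) :
    𝒢.addDist i j = 𝒢.addDist i v + 𝒢.mulDist i v * 𝒢.addDist v j := by
  by_cases h1 : i = v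
  · subst h1; rw [addDist_self 𝒢 hG, mulDist_self 𝒢 hG]; ring
  by_cases h2 : v = j
  · subst h2; rw [addDist_self 𝒢 hG]; ring
  exact (dist_of_cutsBetween 𝒢 hG ((cutsBetween_iff hG).2 ⟨h1, h2, h h1 h2⟩)).2

end

end Distances

/-! ### Principal minors -/

section DetOn

variable {V : Type*} [DecidableEq V] {R : Type*} [CommRing R] {S T : Finset V}
  {f g h : V → V → R} {v : V}

/-- The principal minor of the matrix `f` on the rows and columns in `S`. -/
def detOn (S : Finset V) (f : V → V → R) : R := Matrix.det (Matrix.of fun i j : S => f i j)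

theorem detOn_congr (hfg : ∀ i ∈ S, ∀ j ∈ S, f i j = g i j) : detOn S f = detOn S g := by
  unfold detOn
  congr 1
  ext i j
  exact hfg i i.2 j j.2

theorem detOn_transpose : detOn S (fun i j => f j i) = detOn S f :=
  Matrix.det_transpose (Matrix.of fun i j : S => f i j)

theorem detOn_row_op (hv : v ∈ S) (c : V → R) (hc : c v = 0) :
    detOn S (fun i j => f i j + c i * f v j) = detOn S f :=
  Matrix.det_eq_of_forall_row_eq_smul_add_const (fun i : S => c i) ⟨v, hv⟩ hc fun _ _ => rfl

theorem detOn_col_op (hv : v ∈ S) (c : V → R) (hc : c v = 0) :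
    detOn S (fun i j => f i j + c j * f i v) = detOn S f := by
  rw [← detOn_transpose (f := f), ← detOn_row_op (f := fun i j => f j i) hv c hc,
    ← detOn_transpose]

theorem detOn_union (hST : Disjoint S T) (hf : ∀ i ∈ T, ∀ j ∈ S, f i j = 0) :
    detOn (S ∪ T) f = detOn S f * detOn T f := by
  unfold detOn
  rw [Matrix.twoBlockTriangular_det _ (fun i : (S ∪ T : Finset V) => (i : V) ∈ S)]
  · congr 1
    · let e : S ≃ {i : (S ∪ T : Finset V) // (i : V) ∈ S} :=
        { toFun := fun i => ⟨⟨i, mem_union_left _ i.2⟩, i.2⟩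
          invFun := fun i => ⟨i, i.2⟩
          left_inv := fun _ => rfl
          right_inv := fun _ => rfl }
      rw [← Matrix.det_submatrix_equiv_self e]
      rfl
    · let e : T ≃ {i : (S ∪ T : Finset V) // (i : V) ∉ S} :=
        { toFun := fun i => ⟨⟨i, mem_union_right _ i.2⟩, disjoint_right.1 hST i.2⟩
          invFun := fun i => ⟨i, (mem_union.1 i.1.2).resolve_left i.2⟩
          left_inv := fun _ => rfl
          right_inv := fun _ => rfl }
      rw [← Matrix.det_submatrix_equiv_self e]
      rfl
  · intro i hi j hj
    exact hf i ((mem_union.1 i.2).resolve_left hi) j hj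

theorem detOn_union' (hST : Disjoint S T) (hf : ∀ i ∈ S, ∀ j ∈ T, f i j = 0) :
    detOn (S ∪ T) f = detOn S f * detOn T f := by
  rw [union_comm, detOn_union hST.symm hf, mul_comm]

theorem detOn_singleton : detOn {v} f = f v v := by
  have : Unique ({v} : Finset V) := ⟨⟨⟨v, mem_singleton_self v⟩⟩, fun x =>
    Subtype.ext (mem_singleton.1 x.2)⟩
  unfold detOn
  rw [Matrix.det_unique, Matrix.of_apply, mem_singleton.1 (default : ({v} : Finset V)).2]

theorem detOn_of_card_le_one (hf : ∀ i, f i i = 1) (hS : #S ≤ 1) : detOn S f = 1 := by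
  rcases S.eq_empty_or_nonempty with rfl | ⟨v, hv⟩
  · exact Matrix.det_isEmpty
  · obtain rfl : S = {v} :=
      eq_singleton_iff_unique_mem.2 ⟨hv, fun w hw => card_le_one.1 hS w hw v hv⟩
    rw [detOn_singleton, hf]

theorem detOn_row_add (hv : v ∈ S) (hf : ∀ j ∈ S, f v j = g v j + h v j)
    (hg : ∀ i ∈ S, i ≠ v → ∀ j ∈ S, g i j = f i j)
    (hh : ∀ i ∈ S, i ≠ v → ∀ j ∈ S, h i j = f i j) :
    detOn S f = detOn S g + detOn S h := by
  have key : ∀ k : V → V → R, (∀ i ∈ S, i ≠ v → ∀ j ∈ S, k i j = f i j) →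
      Matrix.of (fun i j : S => k i j) =
        (Matrix.of fun i j : S => f i j).updateRow ⟨v, hv⟩ (fun j => k v j) := by
    intro k hk
    ext i j
    by_cases hi : i = ⟨v, hv⟩
    · subst hi; simp
    · rw [Matrix.updateRow_ne hi]
      exact hk i i.2 (fun h => hi (Subtype.ext h)) j j.2
  have hsum : (Matrix.of fun i j : S => f i j) = (Matrix.of fun i j : S => f i j).updateRow ⟨v, hv⟩
      ((fun j : S => g v j) + fun j : S => h v j) := by
    rw [key f fun _ _ _ _ _ => rfl, Matrix.updateRow_idem]
    congr 1
    ext j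
    exact hf j j.2
  unfold detOn
  rw [key g hg, key h hh, ← Matrix.det_updateRow_add, ← hsum]

theorem detOn_smul (c : R) : detOn S (fun i j => c * f i j) = c ^ #S * detOn S f := by
  unfold detOn
  rw [← Fintype.card_coe, ← Matrix.det_smul]
  rfl

theorem detOn_expand (hv : v ∈ S) (hf : ∀ j ∈ S, j ≠ v → f v j = 0) :
    detOn S f = f v v * detOn (S.erase v) f := by
  have hS : S = {v} ∪ S.erase v := by rw [← insert_eq, insert_erase hv]
  conv_lhs => rw [hS]
  rw [detOn_union' (by simp), detOn_singleton]
  intro i hi j hj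
  obtain rfl := mem_singleton.1 hi
  exact hf j (mem_of_mem_erase hj) (ne_of_mem_erase hj)

theorem detOn_expand_col (hv : v ∈ S) (hf : ∀ i ∈ S, i ≠ v → f i v = 0) :
    detOn S f = f v v * detOn (S.erase v) f := by
  rw [← detOn_transpose, detOn_expand hv hf, detOn_transpose]

end DetOn

section CofSum

variable {R : Type*} [CommRing R] {ι : Type*} [Fintype ι] [DecidableEq ι]

theorem cofSum_eq_sum_det (A : Matrix ι ι R) :
    cofSum A = ∑ i, (A.updateCol i fun _ => 1).det := by
  unfold cofSum
  refine sum_congr rfl fun i _ => ?_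
  rw [← Matrix.cramer_apply, Matrix.cramer_eq_adjugate_mulVec]
  simp [Matrix.mulVec, dotProduct]

/-- Adding a constant to all entries; it is added to the columns of `A` one after the other. -/
theorem det_add_const (A : Matrix ι ι R) (y : R) :
    (Matrix.of fun i j => A i j + y).det = A.det + y * cofSum A := by
  have key : ∀ (A : Matrix ι ι R) (s : Finset ι),
      (Matrix.of fun i j => A i j + if i ∈ s then y else 0).det =
        A.det + y * ∑ i ∈ s, (A.updateRow i fun _ => 1).det := by
    intro A s
    induction s using Finset.induction_on with
    | empty => simp; rfl
    | insert k s hk ih =>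
      rw [sum_insert hk]
      set M : Matrix ι ι R := Matrix.of fun i j => A i j + if i ∈ s then y else 0 with hM
      have h1 : (Matrix.of fun i j => A i j + if i ∈ insert k s then y else 0) =
          M.updateRow k (M k + y • fun _ => 1) := by
        ext i j
        by_cases hi : i = k
        · subst hi; simp [hM, hk]
        · simp [hM, hi]
      have h2 : (M.updateRow k fun _ => 1).det = (A.updateRow k fun _ => 1).det := by
        refine Matrix.det_eq_of_forall_row_eq_smul_add_const
          (fun i => if i ∈ s then y else 0) k (by simp [hk]) fun i j => ?_
        by_cases hi : i = k
        · subst hi; simp [hk]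
        · simp [hM, hi]
      rw [h1, Matrix.det_updateRow_add, Matrix.updateRow_eq_self, ih, Matrix.det_updateRow_smul,
        h2]
      ring
  have h := key A.transpose univ
  simp only [mem_univ, if_true] at h
  rw [cofSum_eq_sum_det, ← Matrix.det_transpose A, ← Matrix.det_transpose (Matrix.of _)]
  refine h.trans ?_
  simp only [Matrix.updateRow_transpose, Matrix.det_transpose]

end CofSum

/-! ### Additive-multiplicative distances across a cut-vertex -/

section Merge

variable {V : Type*} [DecidableEq V] {R : Type*} [CommRing R]

/-- The entries of the matrix whose determinant is the invariant `κ` with base vertex `v`. -/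
def kEntry (m d : V → V → R) (v i j : V) : R := d i j - d i v - m i v * d v j

/-- The invariant `κ` of the vertex set `W` with base vertex `v`. -/
def kappaOn (m d : V → V → R) (W : Finset V) (v : V) : R := detOn (W.erase v) (kEntry m d v)

/-- The matrix that row and column operations with the vertex `v` make of `d + x J`, with the corner
entry replaced by `y`. -/
def bordered (m d : V → V → R) (v : V) (x y : R) (i j : V) : R :=
  if i = v then if j = v then y else d v j
  else if j = v then d i v + x * (1 - m i v) else kEntry m d v i j

variable {m d : V → V → R} {A B W : Finset V} {u v : V} {x y : R}

theorem bordered_of_ne {i j : V} (hi : i ≠ v) (hj : j ≠ v) :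
    bordered m d v x y i j = kEntry m d v i j := by simp [bordered, hi, hj]

theorem detOn_erase_bordered : detOn (W.erase v) (bordered m d v x y) = kappaOn m d W v :=
  detOn_congr fun _ hi _ hj => bordered_of_ne (ne_of_mem_erase hi) (ne_of_mem_erase hj)

theorem detOn_add_const_eq_bordered (hv : v ∈ W) (hd : d v v = 0) :
    detOn W (fun i j => d i j + x) = detOn W (bordered m d v x x) := by
  rw [← detOn_row_op (f := fun i j => d i j + x) hv (fun i => if i = v then 0 else -m i v)
    (by simp), ← detOn_col_op hv (fun i => if i = v then 0 else -1) (by simp)]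
  refine detOn_congr fun i _ j _ => ?_
  unfold bordered kEntry
  by_cases hi : i = v
  · by_cases hj : j = v
    · subst hi; subst hj; simp [hd]
    · subst hi; simp [hj, hd]
  · by_cases hj : j = v
    · subst hj; simp only [hi, hd, if_true, if_false]; ring
    · simp only [hi, hj, hd, if_false]; ring

theorem detOn_bordered (hv : v ∈ W) :
    detOn W (bordered m d v x y) = detOn W (bordered m d v x 0) + y * kappaOn m d W v := by
  rw [detOn_row_add (v := v) (g := bordered m d v x 0)
    (h := fun i j => if i = v then if j = v then y else 0 else bordered m d v x y i j) hv]
  · congr 1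
    rw [detOn_expand hv]
    · simp only [if_true]
      congr 1
      rw [← detOn_erase_bordered (x := x) (y := y)]
      exact detOn_congr fun i hi j _ => by simp [ne_of_mem_erase hi]
    · intro j _ hj; simp [hj]
  · intro j _
    by_cases hj : j = v <;> simp [bordered, hj]
  · intro i _ hi j _; simp [bordered, hi]
  · intro i _ hi j _; simp [hi]

/-- The rules of additive-multiplicative distances from a vertex in `A` to one in `B` through `v`. -/
def PassesThrough (m d : V → V → R) (A B : Finset V) (v : V) : Prop :=
  ∀ a ∈ A, ∀ b ∈ B, m a b = m a v * m v b ∧ d a b = d a v + m a v * d v b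

omit [DecidableEq V] in
theorem PassesThrough.kEntry_eq_zero (h : PassesThrough m d A B v) {i j : V} (hi : i ∈ A)
    (hj : j ∈ B) : kEntry m d v i j = 0 := by
  rw [kEntry, (h i hi j hj).2]; ring

section

variable (hv : A ∩ B = {v}) (hAB : PassesThrough m d A B v) (hBA : PassesThrough m d B A v)
include hv hAB

theorem kappaOn_union : kappaOn m d (A ∪ B) v = kappaOn m d A v * kappaOn m d B v := by
  have hdisj : Disjoint (A.erase v) (B.erase v) := by
    rw [disjoint_left]
    intro i hi hi'
    have : i ∈ A ∩ B := mem_inter.2 ⟨mem_of_mem_erase hi, mem_of_mem_erase hi'⟩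
    rw [hv, mem_singleton] at this
    exact ne_of_mem_erase hi this
  unfold kappaOn
  rw [erase_union_distrib, detOn_union' hdisj]
  exact fun i hi j hj => hAB.kEntry_eq_zero (mem_of_mem_erase hi) (mem_of_mem_erase hj)

include hBA

theorem detOn_bordered_union :
    detOn (A ∪ B) (bordered m d v x 0) =
      detOn A (bordered m d v x 0) * kappaOn m d B v +
        detOn B (bordered m d v x 0) * kappaOn m d A v := by
  have hvAB : v ∈ A ∩ B := by rw [hv]; exact mem_singleton_self v
  obtain ⟨hvA, hvB⟩ := mem_inter.1 hvAB
  have honly : ∀ i ∈ A, i ∈ B → i = v := by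
    intro i hi hi'
    have : i ∈ A ∩ B := mem_inter.2 ⟨hi, hi'⟩
    rwa [hv, mem_singleton] at this
  -- the row of `v` is the sum of its restrictions to `A` and to `B`
  rw [detOn_row_add (v := v)
    (g := fun i j => if i = v ∧ j ∉ A then 0 else bordered m d v x 0 i j)
    (h := fun i j => if i = v ∧ j ∉ B then 0 else bordered m d v x 0 i j)
    (mem_union_left _ hvA)]
  · congr 1
    · have h1 : A ∪ B = A ∪ B.erase v := by
        ext i; simp only [mem_union, mem_erase]
        by_cases hi : i = v
        · subst hi; tauto
        · tauto
      rw [h1, detOn_union']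
      · congr 1
        · exact detOn_congr fun i _ j hj => by simp [hj]
        · rw [← detOn_erase_bordered (x := x) (y := 0)]
          exact detOn_congr fun i hi j _ => by simp [ne_of_mem_erase hi]
      · rw [disjoint_left]
        exact fun i hi hi' => ne_of_mem_erase hi' (honly i hi (mem_of_mem_erase hi'))
      · intro i hi j hj
        have hjA : j ∉ A := fun h => ne_of_mem_erase hj (honly j h (mem_of_mem_erase hj))
        by_cases hiv : i = v
        · simp [hiv, hjA]
        · simp only [hiv, false_and, if_false]
          rw [bordered_of_ne hiv (ne_of_mem_erase hj),
            hAB.kEntry_eq_zero hi (mem_of_mem_erase hj)]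
    · have h1 : A ∪ B = B ∪ A.erase v := by
        ext i; simp only [mem_union, mem_erase]
        by_cases hi : i = v
        · subst hi; tauto
        · tauto
      rw [h1, detOn_union']
      · congr 1
        · exact detOn_congr fun i _ j hj => by simp [hj]
        · rw [← detOn_erase_bordered (x := x) (y := 0)]
          exact detOn_congr fun i hi j _ => by simp [ne_of_mem_erase hi]
      · rw [disjoint_left]
        exact fun i hi hi' => ne_of_mem_erase hi' (honly i (mem_of_mem_erase hi') hi)
      · intro i hi j hj
        have hjB : j ∉ B := fun h => ne_of_mem_erase hj (honly j (mem_of_mem_erase hj) h)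
        by_cases hiv : i = v
        · simp [hiv, hjB]
        · simp only [hiv, false_and, if_false]
          rw [bordered_of_ne hiv (ne_of_mem_erase hj),
            hBA.kEntry_eq_zero hi (mem_of_mem_erase hj)]
  · intro j hj
    by_cases hjv : j = v
    · subst hjv; simp [bordered, hvA, hvB]
    · by_cases hjA : j ∈ A
      · have hjB : j ∉ B := fun h => hjv (honly j hjA h)
        simp [hjA, hjB]
      · have hjB : j ∈ B := (mem_union.1 hj).resolve_left hjA
        simp [hjA, hjB]
  · intro i _ hi j _; simp [hi]
  · intro i _ hi j _; simp [hi]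

omit hAB in
/-- The value of `κ` on a union does not change when the base vertex moves away from the common
vertex. -/
theorem kappaOn_union_of_ne (hdv : d v v = 0) (hmv : m v v = 1) (hu : u ∈ A) (huv : u ≠ v) :
    kappaOn m d (A ∪ B) u = kappaOn m d A u * kappaOn m d B v := by
  have hvAB : v ∈ A ∩ B := by rw [hv]; exact mem_singleton_self v
  obtain ⟨hvA, hvB⟩ := mem_inter.1 hvAB
  have honly : ∀ i ∈ A, i ∈ B → i = v := by
    intro i hi hi'
    have : i ∈ A ∩ B := mem_inter.2 ⟨hi, hi'⟩
    rwa [hv, mem_singleton] at this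
  have hset : (A ∪ B).erase u = A.erase u ∪ B.erase v := by
    ext i; simp only [mem_union, mem_erase]
    constructor
    · rintro ⟨h1, h2 | h2⟩
      · exact Or.inl ⟨h1, h2⟩
      · by_cases hi : i = v
        · subst hi; exact Or.inl ⟨h1, hvA⟩
        · exact Or.inr ⟨hi, h2⟩
    · rintro (⟨h1, h2⟩ | ⟨h1, h2⟩)
      · exact ⟨h1, Or.inl h2⟩
      · refine ⟨?_, Or.inr h2⟩
        rintro rfl
        exact huv (honly _ hu h2)
  have hdisj : ∀ i ∈ A.erase u, i ∉ B.erase v := fun i hi hi' =>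
    ne_of_mem_erase hi' (honly i (mem_of_mem_erase hi) (mem_of_mem_erase hi'))
  unfold kappaOn
  rw [hset, ← detOn_row_op (v := v) (mem_union_left _ (mem_erase.2 ⟨huv.symm, hvA⟩))
    (fun i => if i ∈ B.erase v then -m i v else 0) (by simp), detOn_union]
  · congr 1
    · exact detOn_congr fun i hi j _ => by simp only [hdisj i hi, if_false]; ring
    · refine detOn_congr fun i hi j _ => ?_
      obtain ⟨hm, hd⟩ := hBA i (mem_of_mem_erase hi) u hu
      simp only [hi, if_true, kEntry]
      rw [hm, hd]; ring
  · exact disjoint_left.2 hdisj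
  · intro i hi j hj
    obtain ⟨hm, hd⟩ := hBA i (mem_of_mem_erase hi) u hu
    obtain ⟨hm', hd'⟩ := hBA i (mem_of_mem_erase hi) j (mem_of_mem_erase hj)
    simp only [hi, if_true, kEntry]
    rw [hm, hd, hd']; ring

end

end Merge

/-! ### Determinants of connected sets of vertices -/

section SingleBlock

variable {V : Type*} [DecidableEq V] {R : Type*} [CommRing R] {m d : V → V → R} {S : Finset V}
  {a : R} {v : V}

/-- The cofactor-sum of a principal submatrix. -/
def cofOn (S : Finset V) (f : V → V → R) : R := cofSum (Matrix.of fun i j : S => f i j)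

/-- Inside a block, `κ` is a Schur complement of the multiplicative distance matrix; in particular
it does not depend on the base vertex. -/
theorem kappaOn_block (hd : ∀ i ∈ S, ∀ j ∈ S, d i j = a * (m i j - 1)) (hv : v ∈ S)
    (hm : m v v = 1) : kappaOn m d S v = a ^ (#S - 1) * detOn S m := by
  have h1 : kappaOn m d S v =
      detOn (S.erase v) (fun i j => a * (m i j - m i v * m v j)) := by
    refine detOn_congr fun i hi j hj => ?_
    have hi := mem_of_mem_erase hi
    have hj := mem_of_mem_erase hj
    rw [kEntry, hd i hi j hj, hd i hi v hv, hd v hv j hj]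
    ring
  rw [h1, detOn_smul, card_erase_of_mem hv]
  congr 1
  rw [← detOn_row_op (f := m) hv (fun i => if i = v then 0 else -m i v) (by simp),
    detOn_expand_col hv]
  · simp only [if_true, zero_mul, add_zero, hm, one_mul]
    refine detOn_congr fun i hi j _ => ?_
    simp only [ne_of_mem_erase hi, if_false]
    ring
  · intro i _ hi
    simp [hi, hm]

theorem detOn_block_add_const (hd : ∀ i ∈ S, ∀ j ∈ S, d i j = a * (m i j - 1)) (hv : v ∈ S)
    (hm : m v v = 1) (x : R) :
    detOn S (fun i j => d i j + x) =
      x * kappaOn m d S v + (a - x) * (kappaOn m d S v - cofOn S d) := by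
  have hconst : ∀ y, detOn S (fun i j => d i j + y) = detOn S d + y * cofOn S d := fun y =>
    det_add_const (Matrix.of fun i j : S => d i j) y
  -- for `y = a` the matrix `d + y J` is a multiple of the multiplicative distance matrix
  have ha : detOn S (fun i j => d i j + a) = a * kappaOn m d S v := by
    rw [kappaOn_block hd hv hm, ← mul_assoc, ← pow_succ',
      Nat.sub_add_cancel (card_pos.2 ⟨v, hv⟩), ← detOn_smul]
    refine detOn_congr fun i hi j hj => ?_
    rw [hd i hi j hj]; ring
  rw [hconst] at ha
  rw [hconst]
  linear_combination ha

end SingleBlock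

section Leibniz

variable {ι R : Type*} [Fintype ι] [DecidableEq ι] [CommRing R]

/-- The expression in the formula for the determinant obeys the product rule. -/
theorem sum_mul_prod_erase_leibniz {c k₁ k₂ k s₁ s₂ s : ι → R} (hk : ∀ e, k e = k₁ e * k₂ e)
    (hs : ∀ e, s e = s₁ e * k₂ e + s₂ e * k₁ e) :
    ∑ e, c e * s e * ∏ f ∈ univ.erase e, k f =
      (∑ e, c e * s₁ e * ∏ f ∈ univ.erase e, k₁ f) * ∏ e, k₂ e +
        (∑ e, c e * s₂ e * ∏ f ∈ univ.erase e, k₂ f) * ∏ e, k₁ e := by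
  rw [sum_mul, sum_mul, ← sum_add_distrib]
  refine sum_congr rfl fun e _ => ?_
  simp only [hk, hs, prod_mul_distrib]
  rw [← mul_prod_erase univ k₁ (mem_univ e), ← mul_prod_erase univ k₂ (mem_univ e)]
  ring

end Leibniz

section Connected

variable {V : Type*} [Fintype V] [DecidableEq V] {G : Digraph V} {R : Type*} [CommRing R]
  (𝒢 : BlockDatum G R) (e : StrongBlock G) (W A B : Finset V) (u v : V)

/-- The factor that the block `e` contributes to the invariant `κ` of `W`; it is `1` if the trace of
`e` on `W` has at most one vertex. -/
noncomputable def blockKappa : R := 𝒢.a e ^ (#(e.1 ∩ W) - 1) * detOn (e.1 ∩ W) 𝒢.mulDist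

/-- The difference of the invariant `κ` and the cofactor-sum for the trace of `e` on `W`, set to `0`
for traces with at most one vertex. -/
noncomputable def blockDefect : R :=
  if 2 ≤ #(e.1 ∩ W) then blockKappa 𝒢 e W - cofOn (e.1 ∩ W) 𝒢.addDist else 0

variable [Nonempty V] (hG : ∀ a b, ConnOn (und G) Set.univ a b)
variable {e W A B u v}

include hG in
theorem blockKappa_of_card_le_one (h : #(e.1 ∩ W) ≤ 1) : blockKappa 𝒢 e W = 1 := by
  rw [blockKappa, detOn_of_card_le_one (mulDist_self 𝒢 hG) h, Nat.sub_eq_zero_of_le h]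
  simp

omit [Nonempty V] in
theorem blockDefect_of_card_le_one (h : #(e.1 ∩ W) ≤ 1) : blockDefect 𝒢 e W = 0 := by
  rw [blockDefect, if_neg (by omega)]

omit [Nonempty V] in
theorem blockKappa_congr (h : e.1 ∩ A = e.1 ∩ B) : blockKappa 𝒢 e A = blockKappa 𝒢 e B := by
  rw [blockKappa, blockKappa, h]

omit [Nonempty V] in
theorem blockDefect_congr (h : e.1 ∩ A = e.1 ∩ B) : blockDefect 𝒢 e A = blockDefect 𝒢 e B := by
  rw [blockDefect, blockDefect, h, blockKappa_congr 𝒢 h]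

include hG

omit [DecidableEq V] in
theorem passesThrough (h : ∀ a ∈ A, ∀ b ∈ B, a ≠ v → b ≠ v → ¬ ConnOn (und G) {v}ᶜ a b) :
    PassesThrough 𝒢.mulDist 𝒢.addDist A B v := fun a ha b hb =>
  ⟨mulDist_of_separates 𝒢 hG fun h1 h2 => h a ha b hb h1 h2.symm,
    addDist_of_separates 𝒢 hG fun h1 h2 => h a ha b hb h1 h2.symm⟩

/-- No block has vertices on both sides of a cut-vertex. -/
theorem trace_trivial (hsep : ∀ a ∈ A, ∀ b ∈ B, a ≠ v → b ≠ v → ¬ ConnOn (und G) {v}ᶜ a b)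
    (hv : A ∩ B = {v}) (e : StrongBlock G) :
    (e.1 ∩ (A ∪ B) = e.1 ∩ A ∧ #(e.1 ∩ B) ≤ 1) ∨ (e.1 ∩ (A ∪ B) = e.1 ∩ B ∧ #(e.1 ∩ A) ≤ 1) := by
  have hvA : v ∈ A ∧ v ∈ B := by rw [← mem_inter, hv]; exact mem_singleton_self v
  by_cases h : e.1 ∩ B ⊆ {v}
  · refine Or.inl ⟨?_, (card_le_card h).trans (by simp)⟩
    rw [inter_union_distrib_left, union_eq_left]
    intro i hi
    obtain rfl := mem_singleton.1 (h hi)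
    exact mem_inter.2 ⟨mem_of_mem_inter_left hi, hvA.1⟩
  · obtain ⟨b, hb, hbv⟩ := not_subset.1 h
    rw [mem_singleton] at hbv
    have hA : e.1 ∩ A ⊆ {v} := by
      intro a ha
      rw [mem_singleton]
      by_contra hav
      rw [mem_inter] at ha hb
      exact hsep a ha.2 b hb.2 hav hbv
        ((e.maximal hG).1 a ha.1 b hb.1 v (Ne.symm hav) (Ne.symm hbv))
    refine Or.inr ⟨?_, (card_le_card hA).trans (by simp)⟩
    rw [inter_union_distrib_left, union_eq_right]
    intro i hi
    obtain rfl := mem_singleton.1 (hA hi)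
    exact mem_inter.2 ⟨mem_of_mem_inter_left hi, hvA.2⟩

/-- The invariant `κ` of a connected set of vertices is the product of the contributions of the
blocks, whatever the base vertex, and the determinant of `D + x J` is given by the product rule. -/
theorem kappaOn_and_detOn (x : R) (hW : ∀ a ∈ W, ∀ b ∈ W, ConnOn (und G) W a b)
    (hne : W.Nonempty) :
    (∀ u ∈ W, kappaOn 𝒢.mulDist 𝒢.addDist W u = ∏ e, blockKappa 𝒢 e W) ∧
      detOn W (fun i j => 𝒢.addDist i j + x) = x * ∏ e, blockKappa 𝒢 e W +
        ∑ e, (𝒢.a e - x) * blockDefect 𝒢 e W * ∏ f ∈ univ.erase e, blockKappa 𝒢 f W := by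
  induction hn : #W using Nat.strong_induction_on generalizing W with
  | _ n ih =>
  subst hn
  by_cases hblock : ∃ S, Maximal (InsepSet (und G)) S ∧ W ⊆ S
  · obtain ⟨S, hS, hWS⟩ := hblock
    obtain ⟨e, he⟩ : ∃ e : StrongBlock G, e.1 = S := ⟨⟨S, (isBlockIn_univ_iff hG).2 hS⟩, rfl⟩
    subst he
    have heW : e.1 ∩ W = W := inter_eq_right.2 hWS
    have hd : ∀ i ∈ W, ∀ j ∈ W, 𝒢.addDist i j = 𝒢.a e * (𝒢.mulDist i j - 1) :=
      fun i hi j hj => addDist_block 𝒢 hG e (hWS hi) (hWS hj)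
    have hother : ∀ f : StrongBlock G, f ≠ e → #(f.1 ∩ W) ≤ 1 := by
      intro f hf
      rw [card_le_one]
      intro i hi j hj
      by_contra hij
      rw [mem_inter] at hi hj
      exact hf (strongBlock_eq hG hij hi.1 hj.1 (hWS hi.2) (hWS hj.2))
    have hprod : ∏ f ∈ univ.erase e, blockKappa 𝒢 f W = 1 :=
      prod_eq_one fun f hf => blockKappa_of_card_le_one 𝒢 hG (hother f (ne_of_mem_erase hf))
    have hk : ∏ f, blockKappa 𝒢 f W = blockKappa 𝒢 e W := by
      rw [← mul_prod_erase univ _ (mem_univ e), hprod, mul_one]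
    have hku : ∀ u ∈ W, kappaOn 𝒢.mulDist 𝒢.addDist W u = blockKappa 𝒢 e W := fun u hu => by
      rw [kappaOn_block hd hu (mulDist_self 𝒢 hG u), blockKappa, heW]
    rw [hk]
    refine ⟨hku, ?_⟩
    rw [sum_eq_single e (fun f _ hf => by
      rw [blockDefect_of_card_le_one 𝒢 (hother f hf)]; ring) (fun h => absurd (mem_univ e) h),
      hprod, mul_one]
    obtain ⟨v, hv⟩ := hne
    by_cases hcard : 2 ≤ #W
    · rw [detOn_block_add_const hd hv (mulDist_self 𝒢 hG v), hku v hv, blockDefect, heW,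
        if_pos hcard]
    · obtain rfl : W = {v} := eq_singleton_iff_unique_mem.2
        ⟨hv, fun w hw => card_le_one.1 (by omega) w hw v hv⟩
      rw [detOn_singleton, addDist_self 𝒢 hG, blockDefect_of_card_le_one 𝒢 (by rw [heW]; simp),
        blockKappa_of_card_le_one 𝒢 hG (by rw [heW]; simp)]
      ring
  · obtain ⟨v, A, B, rfl, hv, hA, hB, hcA, hcB, hsep⟩ :=
      exists_split hW (fun S hS hWS => hblock ⟨S, hS, hWS⟩)
    have hvAB : v ∈ A ∩ B := by rw [hv]; exact mem_singleton_self v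
    obtain ⟨hvA, hvB⟩ := mem_inter.1 hvAB
    have hsep' : ∀ b ∈ B, ∀ a ∈ A, b ≠ v → a ≠ v → ¬ ConnOn (und G) {v}ᶜ b a :=
      fun b hb a ha h1 h2 h => hsep a ha b hb h2 h1 h.symm
    have hAB := passesThrough 𝒢 hG hsep
    have hBA := passesThrough 𝒢 hG hsep'
    have hd := addDist_self 𝒢 hG v
    have hm := mulDist_self 𝒢 hG v
    obtain ⟨ihA, ihA'⟩ := ih _ hA hcA ⟨v, hvA⟩ rfl
    obtain ⟨ihB, ihB'⟩ := ih _ hB hcB ⟨v, hvB⟩ rfl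
    have hkap : ∀ e : StrongBlock G,
        blockKappa 𝒢 e (A ∪ B) = blockKappa 𝒢 e A * blockKappa 𝒢 e B := by
      intro e
      rcases trace_trivial hG hsep hv e with ⟨h1, h2⟩ | ⟨h1, h2⟩
      · rw [blockKappa_of_card_le_one 𝒢 hG h2, blockKappa_congr 𝒢 h1, mul_one]
      · rw [blockKappa_of_card_le_one 𝒢 hG h2, blockKappa_congr 𝒢 h1, one_mul]
    have hdef : ∀ e : StrongBlock G, blockDefect 𝒢 e (A ∪ B) =
        blockDefect 𝒢 e A * blockKappa 𝒢 e B + blockDefect 𝒢 e B * blockKappa 𝒢 e A := by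
      intro e
      rcases trace_trivial hG hsep hv e with ⟨h1, h2⟩ | ⟨h1, h2⟩
      · rw [blockKappa_of_card_le_one 𝒢 hG h2, blockDefect_congr 𝒢 h1,
          blockDefect_of_card_le_one 𝒢 h2]
        ring
      · rw [blockKappa_of_card_le_one 𝒢 hG h2, blockDefect_congr 𝒢 h1,
          blockDefect_of_card_le_one 𝒢 h2]
        ring
    have hprod : ∏ e, blockKappa 𝒢 e (A ∪ B) =
        (∏ e, blockKappa 𝒢 e A) * ∏ e, blockKappa 𝒢 e B := by
      rw [← prod_mul_distrib]; exact prod_congr rfl fun e _ => hkap e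
    constructor
    · intro u hu
      rw [hprod]
      by_cases huv : u = v
      · subst huv
        rw [kappaOn_union hv hAB, ihA u hvA, ihB u hvB]
      rcases mem_union.1 hu with hu | hu
      · rw [kappaOn_union_of_ne hv hBA hd hm hu huv, ihA u hu, ihB v hvB]
      · rw [union_comm, kappaOn_union_of_ne (by rwa [inter_comm]) hAB hd hm hu huv, ihB u hu,
          ihA v hvA, mul_comm]
    · rw [sum_mul_prod_erase_leibniz hkap hdef, hprod,
        detOn_add_const_eq_bordered (mem_union_left _ hvA) hd,
        detOn_bordered (mem_union_left _ hvA), detOn_bordered_union hv hAB hBA,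
        kappaOn_union hv hAB, ihA v hvA, ihB v hvB]
      rw [detOn_add_const_eq_bordered hvA hd, detOn_bordered hvA, ihA v hvA] at ihA'
      rw [detOn_add_const_eq_bordered hvB hd, detOn_bordered hvB, ihB v hvB] at ihB'
      linear_combination (∏ e, blockKappa 𝒢 e B) * ihA' + (∏ e, blockKappa 𝒢 e A) * ihB'

end Connected

/-! ### Trace blocks -/

section Traces

variable {V : Type*} [Fintype V] [DecidableEq V] [Nonempty V] {G : Digraph V} {R : Type*}
  [CommRing R] (𝒢 : BlockDatum G R) {W : Finset V} (hG : ∀ a b, ConnOn (und G) Set.univ a b)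
include hG

theorem traceMul_apply (e : TraceBlock G W) (i j : {v // v ∈ e.verts}) :
    𝒢.traceMul e i j = 𝒢.mulDist i j :=
  (mulDist_block 𝒢 hG e.1 _ _).symm

theorem traceDist_apply (e : TraceBlock G W) (i j : {v // v ∈ e.verts}) :
    𝒢.traceDist e i j = 𝒢.addDist i j := by
  rw [addDist_block 𝒢 hG e.1 (mem_inter.1 i.2).1 (mem_inter.1 j.2).1, ← traceMul_apply 𝒢 hG e i j]
  rfl

theorem traceKappa_eq (e : TraceBlock G W) (r : {v // v ∈ e.verts}) :
    𝒢.traceKappa e r = blockKappa 𝒢 e.1 W := by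
  have hd : ∀ i ∈ e.verts, ∀ j ∈ e.verts,
      𝒢.addDist i j = 𝒢.a e.1 * (𝒢.mulDist i j - 1) :=
    fun i hi j hj => addDist_block 𝒢 hG e.1 (mem_inter.1 hi).1 (mem_inter.1 hj).1
  rw [blockKappa, ← kappaOn_block hd r.2 (mulDist_self 𝒢 hG r)]
  let φ : {i : {v // v ∈ e.verts} // i ≠ r} ≃ (e.verts.erase r.1 : Finset V) :=
    { toFun := fun i => ⟨i.1.1, mem_erase.2 ⟨fun h => i.2 (Subtype.ext h), i.1.2⟩⟩
      invFun := fun i => ⟨⟨i.1, mem_of_mem_erase i.2⟩,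
        fun h => ne_of_mem_erase i.2 (congrArg Subtype.val h)⟩
      left_inv := fun _ => rfl
      right_inv := fun _ => rfl }
  unfold BlockDatum.traceKappa kappa kappaOn detOn
  rw [← Matrix.det_submatrix_equiv_self φ]
  congr 1
  ext i j
  simp only [Matrix.of_apply, Matrix.submatrix_apply, traceDist_apply 𝒢 hG, traceMul_apply 𝒢 hG]
  rfl

theorem traceKappa_sub_cofSum (e : TraceBlock G W) (r : {v // v ∈ e.verts}) :
    𝒢.traceKappa e r - cofSum (𝒢.traceDist e) = blockDefect 𝒢 e.1 W := by
  rw [blockDefect, if_pos e.2, traceKappa_eq 𝒢 hG, cofOn]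
  congr 2
  ext i j
  exact traceDist_apply 𝒢 hG e i j

/-- Blocks with a trivial trace do not contribute to a product of `κ`s. -/
theorem prod_traceKappa (r : (e : TraceBlock G W) → {v // v ∈ e.verts})
    (s : Finset (TraceBlock G W)) (t : Finset (StrongBlock G))
    (hst : ∀ e, e ∈ s ↔ e.1 ∈ t) :
    ∏ e ∈ s, 𝒢.traceKappa e (r e) = ∏ e ∈ t, blockKappa 𝒢 e W := by
  have h1 : s = t.subtype fun e => 2 ≤ #(e.1 ∩ W) := by
    ext e; rw [hst, mem_subtype]
  rw [prod_congr rfl fun e _ => traceKappa_eq 𝒢 hG e (r e), h1,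
    prod_subtype_eq_prod_filter (s := t) (fun e => blockKappa 𝒢 e W), prod_filter_of_ne]
  intro e _ he
  by_contra h
  exact he (blockKappa_of_card_le_one 𝒢 hG (by omega))

theorem detOn_eq_sum_traceBlock (x : R) (hW : ∀ a ∈ W, ∀ b ∈ W, ConnOn (und G) W a b)
    (hne : W.Nonempty) (r : (e : TraceBlock G W) → {v // v ∈ e.verts}) :
    detOn W (fun i j => 𝒢.addDist i j + x) =
      x * ∏ e, 𝒢.traceKappa e (r e) +
        ∑ e, (𝒢.traceWeight e - x) * (𝒢.traceKappa e (r e) - cofSum (𝒢.traceDist e)) *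
          ∏ f ∈ univ.erase e, 𝒢.traceKappa f (r f) := by
  rw [(kappaOn_and_detOn 𝒢 hG x hW hne).2,
    prod_traceKappa 𝒢 hG r univ univ (by simp)]
  congr 1
  have h1 : ∀ e : TraceBlock G W,
      (𝒢.traceWeight e - x) * (𝒢.traceKappa e (r e) - cofSum (𝒢.traceDist e)) *
          ∏ f ∈ univ.erase e, 𝒢.traceKappa f (r f) =
        (𝒢.a e.1 - x) * blockDefect 𝒢 e.1 W * ∏ f ∈ univ.erase e.1, blockKappa 𝒢 f W := by
    intro e
    rw [traceKappa_sub_cofSum 𝒢 hG, prod_traceKappa 𝒢 hG r (univ.erase e) (univ.erase e.1)]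
    · rfl
    · intro f
      simp only [mem_erase, mem_univ, and_true, Ne, Subtype.ext_iff]
  rw [sum_congr rfl fun e _ => h1 e]
  have h2 : (univ : Finset (TraceBlock G W)) =
      (univ : Finset (StrongBlock G)).subtype fun e => 2 ≤ #(e.1 ∩ W) := by
    ext e; simp
  rw [h2, sum_subtype_eq_sum_filter (s := univ) (fun e : StrongBlock G =>
    (𝒢.a e - x) * blockDefect 𝒢 e W * ∏ f ∈ univ.erase e, blockKappa 𝒢 f W), sum_filter_of_ne]
  intro e _ he
  by_contra h
  refine he ?_
  rw [blockDefect_of_card_le_one 𝒢 (by omega)]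
  ring

omit 𝒢 in
/-- If the traces of the blocks are nonseparable, they are the blocks of the induced subgraph. -/
theorem isBlockIn_iff_traceBlock (hW : ∀ a ∈ W, ∀ b ∈ W, ConnOn (und G) W a b) (hcard : 2 ≤ #W)
    (htr : ∀ e : TraceBlock G W, Nonseparable G e.verts) (B : Finset V) :
    IsBlockIn G W B ↔ ∃ e : TraceBlock G W, e.verts = B := by
  constructor
  · intro hB
    obtain ⟨e, he⟩ := exists_strongBlock hG hB.1.2.insepSet
    have hBe : B ⊆ e.1 ∩ W := subset_inter he hB.1.1
    by_cases h2 : 2 ≤ #(e.1 ∩ W)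
    · exact ⟨⟨e, h2⟩, (hB.2 ⟨inter_subset_right, htr ⟨e, h2⟩⟩ hBe).antisymm hBe⟩
    -- a single vertex is not maximal, since it has a neighbor in `W`
    exfalso
    obtain ⟨⟨w, hw⟩⟩ := hB.1.2.1.nonempty
    have hB1 : #B ≤ 1 := (card_le_card hBe).trans (by omega)
    obtain ⟨w', hw', hww'⟩ := exists_mem_ne (by omega : 1 < #W) w
    obtain ⟨z, hz, hwz⟩ := (hW w (hB.1.1 hw) w' hw').exists_adj hww'.symm
    have hBw : B ⊆ {w, z} := fun b hb => by
      rw [card_le_one.1 hB1 b hb w hw]; simp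
    have hsub : ({w, z} : Finset V) ⊆ W := by
      intro t ht
      rw [mem_insert, mem_singleton] at ht
      rcases ht with rfl | rfl
      exacts [hB.1.1 hw, hz]
    have hzB : z ∈ B := hB.2 ⟨hsub, nonseparable_pair hwz⟩ hBw (by simp)
    exact hwz.ne (card_le_one.1 hB1 w hw z hzB)
  · rintro ⟨e, rfl⟩
    refine ⟨⟨inter_subset_right, htr e⟩, ?_⟩
    rintro T ⟨hTW, hT⟩ hle
    obtain ⟨f, hf⟩ := exists_strongBlock hG hT.insepSet
    obtain ⟨a, ha, b, hb, hab⟩ := one_lt_card.1 (by have := e.2; omega : 1 < #(e.1.1 ∩ W))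
    have hef : e.1 = f := strongBlock_eq hG hab (mem_inter.1 ha).1 (mem_inter.1 hb).1
      (hf (hle ha)) (hf (hle hb))
    exact subset_inter (hef ▸ hf) hTW

end Traces

/-! ### Minors with different row and column sets -/

section Minors

variable {V : Type*} {R : Type*} [CommRing R]

/-- Two rows that are multiples of the all-ones row modulo other rows make a determinant vanish. -/
theorem det_eq_zero_of_two_rows {ι : Type*} [Fintype ι] [DecidableEq ι] {X : Matrix ι ι R}
    {q₁ q₂ w₁ w₂ : ι} (hq : q₁ ≠ q₂) (h₁ : w₁ ≠ q₁) (h₂ : w₂ ≠ q₂) (h₃ : w₂ ≠ q₁)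
    {c₁ c₂ b₁ b₂ : R} (hX₁ : ∀ t, X q₁ t = c₁ * X w₁ t + b₁)
    (hX₂ : ∀ t, X q₂ t = c₂ * X w₂ t + b₂) : X.det = 0 := by
  have e1 : X q₁ + (-c₁) • X w₁ = b₁ • fun _ => 1 := by
    ext t; simp [hX₁ t]
  rw [← Matrix.det_updateRow_add_smul_self X h₁.symm (-c₁), e1]
  set Y := X.updateRow q₁ (b₁ • fun _ => 1) with hY
  have e2 : Y q₂ + (-c₂) • Y w₂ = b₂ • fun _ => 1 := by
    ext t
    simp [hY, hq.symm, h₃, hX₂ t]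
  rw [← Matrix.det_updateRow_add_smul_self Y h₂.symm (-c₂), e2, Matrix.det_updateRow_smul, hY,
    Matrix.updateRow_comm _ hq, Matrix.det_updateRow_smul, Matrix.det_zero_of_row_eq hq]
  · simp
  · ext t; simp [hq.symm]

theorem detOn_swap_col [DecidableEq V] {S : Finset V} {f : V → V → R} {a b : V} (ha : a ∈ S)
    (hb : b ∈ S) (hab : a ≠ b) :
    detOn S (fun i j => f i (Equiv.swap a b j)) = -detOn S f := by
  have h := Matrix.det_permute' (Equiv.swap (⟨a, ha⟩ : S) ⟨b, hb⟩) (Matrix.of fun i j : S => f i j)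
  rw [Equiv.Perm.sign_swap (by simpa [Subtype.ext_iff] using hab)] at h
  simp only [Units.val_neg, Units.val_one, Int.cast_neg, Int.cast_one, neg_mul, one_mul] at h
  unfold detOn
  rw [← h]
  congr 1
  ext i j
  simp only [Matrix.of_apply, Matrix.submatrix_apply, id]
  congr 1
  simp only [Equiv.swap_apply_def, Subtype.ext_iff]
  split_ifs <;> rfl

variable [LinearOrder V]

/-- Omitting the vertex at position `k` of `W` from the increasing enumeration of `W`. -/
theorem orderEmbOfFin_succAbove {n : ℕ} {W S : Finset V} (hW : #W = n + 1) (hS : #S = n)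
    {k : Fin (n + 1)} (hk : S = W.erase (W.orderEmbOfFin hW k)) :
    (S.orderEmbOfFin hS : Fin n → V) = W.orderEmbOfFin hW ∘ k.succAbove := by
  refine (orderEmbOfFin_unique hS (fun x => ?_) ?_).symm
  · rw [hk, mem_erase]
    exact ⟨fun h => Fin.succAbove_ne k x ((W.orderEmbOfFin hW).injective h),
      orderEmbOfFin_mem W hW _⟩
  · exact (W.orderEmbOfFin hW).strictMono.comp (Fin.strictMono_succAbove k)

theorem card_filter_lt_orderEmbOfFin {n : ℕ} {W : Finset V} (hW : #W = n) (k : Fin n) :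
    #(W.filter (· < W.orderEmbOfFin hW k)) = k := by
  have h : W.filter (· < W.orderEmbOfFin hW k) = (Iio k).image (W.orderEmbOfFin hW) := by
    ext v
    simp only [mem_filter, mem_image, mem_Iio]
    constructor
    · rintro ⟨hv, hlt⟩
      obtain ⟨l, rfl⟩ : v ∈ Set.range (W.orderEmbOfFin hW) := by
        rw [range_orderEmbOfFin]; exact hv
      exact ⟨l, (W.orderEmbOfFin hW).lt_iff_lt.1 hlt, rfl⟩
    · rintro ⟨l, hl, rfl⟩
      exact ⟨orderEmbOfFin_mem W hW l, (W.orderEmbOfFin hW).lt_iff_lt.2 hl⟩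
  rw [h, card_image_of_injective _ (W.orderEmbOfFin hW).injective, Fin.card_Iio]

variable [Fintype V]

theorem minorDet_self (A : Matrix V V R) (I : Finset V) : minorDet A I I rfl = detOn Iᶜ A := by
  unfold minorDet detOn
  rw [← Matrix.det_submatrix_equiv_self (Iᶜ.orderIsoOfFin rfl).toEquiv]
  rfl

/-- If one row and one column of a principal submatrix are removed, the minor is a cofactor up to
sign, and the cofactor arises from replacing the row by a standard basis vector. -/
theorem minorDet_eq_cofactor (A : Matrix V V R) {I J W : Finset V} (h : #I = #J) {i₀ j₀ : V}
    (hi : i₀ ∈ W) (hj : j₀ ∈ W) (hI : Iᶜ = W.erase i₀) (hJ : Jᶜ = W.erase j₀) :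
    minorDet A I J h = (-1) ^ (#(W.filter (· < i₀)) + #(W.filter (· < j₀))) *
      detOn W (fun i j => if i = i₀ then if j = j₀ then 1 else 0 else A i j) := by
  have hW : #W = #Iᶜ + 1 := by rw [hI, card_erase_add_one hi]
  unfold minorDet
  have hJ' : #Jᶜ = #Iᶜ := by rw [card_compl, card_compl, h]
  obtain ⟨k, rfl⟩ : i₀ ∈ Set.range (W.orderEmbOfFin hW) := by
    rw [range_orderEmbOfFin]; exact hi
  obtain ⟨l, rfl⟩ : j₀ ∈ Set.range (W.orderEmbOfFin hW) := by
    rw [range_orderEmbOfFin]; exact hj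
  rw [card_filter_lt_orderEmbOfFin, card_filter_lt_orderEmbOfFin,
    orderEmbOfFin_succAbove hW rfl hI, orderEmbOfFin_succAbove hW hJ' hJ]
  set φ := W.orderEmbOfFin hW
  have h1 := Matrix.adjugate_fin_succ_eq_det_submatrix (A.submatrix φ φ) l k
  have h2 : detOn W (fun i j => if i = φ k then if j = φ l then 1 else 0 else A i j) =
      (A.submatrix φ φ).adjugate l k := by
    rw [Matrix.adjugate_apply]
    unfold detOn
    rw [← Matrix.det_submatrix_equiv_self (W.orderIsoOfFin hW).toEquiv]
    congr 1
    ext i j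
    have hφ : ∀ i, (((W.orderIsoOfFin hW).toEquiv i : W) : V) = φ i := fun _ => rfl
    simp only [Matrix.submatrix_apply, Matrix.of_apply, hφ, φ.injective.eq_iff]
    by_cases hik : i = k
    · subst hik; simp [Pi.single_apply]
    · simp [hik]
  rw [h2, h1, ← mul_assoc, ← mul_pow, neg_one_mul, neg_neg, one_pow, one_mul]
  rfl

end Minors

section Cofactor

variable {V : Type*} [DecidableEq V] {R : Type*} [CommRing R] {m d : V → V → R}

/-- The cofactor at a row `i₀` and a column `j₀` that are reached through `p` and `q` only. Two row
and column operations turn the column of `i₀` into a multiple of the column `m · p` and the row of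
`j₀` into a multiple of the all-ones row, and the remaining bordered determinant is `κ` with base
vertex `p`. -/
theorem detOn_cofactor {W : Finset V} {i₀ j₀ p q : V} {x : R} (hi : i₀ ∈ W) (hj : j₀ ∈ W)
    (hp : p ∈ W) (hq : q ∈ W) (hij : i₀ ≠ j₀) (hpi : p ≠ i₀) (hpj : p ≠ j₀) (hqi : q ≠ i₀)
    (hqj : q ≠ j₀) (hcol : ∀ i ∈ W, i ≠ i₀ → d i i₀ = d i p + m i p * d p i₀)
    (hrow : ∀ j ∈ W, j ≠ j₀ → d j₀ j = d j₀ q + m j₀ q * d q j)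
    (hm : m j₀ p = m j₀ q * m q p) (hd : d p p = 0) (hmp : m p p = 1) :
    detOn W (fun i j => if i = i₀ then if j = j₀ then 1 else 0 else d i j + x) =
      d p i₀ * (d j₀ q + x * (1 - m j₀ q)) * kappaOn m d ((W.erase i₀).erase j₀) p := by
  set β := d j₀ q + x * (1 - m j₀ q) with hβ
  have hpE : p ∈ W.erase i₀ := mem_erase.2 ⟨hpi, hp⟩
  have hjE : j₀ ∈ W.erase i₀ := mem_erase.2 ⟨hij.symm, hj⟩
  have hpA : p ∈ (W.erase i₀).erase j₀ := mem_erase.2 ⟨hpj, hpE⟩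
  have step1 : detOn W (fun i j => if i = i₀ then if j = j₀ then 1 else 0 else d i j + x) =
      -detOn (W.erase i₀) (fun i j =>
        if j = j₀ then if i = j₀ then 0 else m i p * d p i₀
        else if i = j₀ then β else d i j + x) := by
    rw [← detOn_col_op hp (fun j => if j = i₀ then -1 else 0) (by simp [hpi]),
      ← detOn_row_op hq (fun i => if i = j₀ then -m j₀ q else 0) (by simp [hqj]),
      ← neg_eq_iff_eq_neg, ← detOn_swap_col hi hj hij, detOn_expand hi]
    · simp only [Equiv.swap_apply_left, if_true, hij, hij.symm, hpj, if_false]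
      simp only [mul_zero, add_zero, zero_mul, one_mul]
      refine detOn_congr fun i hi' j hj' => ?_
      obtain ⟨hi1, hi2⟩ := mem_erase.1 hi'
      obtain ⟨hj1, hj2⟩ := mem_erase.1 hj'
      simp only [hi1, if_false, hqi]
      by_cases hjj : j = j₀
      · subst hjj
        simp only [Equiv.swap_apply_right, if_true]
        by_cases hii : i = j
        · subst hii
          simp only [if_true]
          rw [hcol i hi2 hi1, hcol q hq hqi, hm]; ring
        · simp only [hii, if_false]
          rw [hcol i hi2 hi1]; ring
      · rw [Equiv.swap_apply_of_ne_of_ne hj1 hjj]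
        simp only [hjj, hj1, if_false]
        by_cases hii : i = j₀
        · subst hii
          simp only [if_true]
          rw [hrow j hj2 hjj, hβ]; ring
        · simp only [hii, if_false]; ring
    · intro j _ hji
      by_cases hjj : j = j₀
      · subst hjj
        simp [Equiv.swap_apply_right, hij, hpj]
      · simp [Equiv.swap_apply_of_ne_of_ne hji hjj, hjj, hij, hpj]
  have step2 : detOn (W.erase i₀) (fun i j =>
        if j = j₀ then if i = j₀ then 0 else m i p * d p i₀
        else if i = j₀ then β else d i j + x) =
      -(β * (d p i₀ * detOn (((W.erase i₀).erase j₀).erase p) (kEntry m d p))) := by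
    rw [← detOn_col_op hpE (fun j => if j = p ∨ j = j₀ then 0 else -1) (by simp),
      ← detOn_row_op hpE (fun i => if i = p ∨ i = j₀ then 0 else -m i p) (by simp),
      ← neg_eq_iff_eq_neg, ← detOn_swap_col hjE hpE hpj.symm, detOn_expand hjE,
      detOn_expand_col hpA]
    · congr 1
      · simp [hpj]
      congr 1
      · simp [hpj, hmp]
      refine detOn_congr fun i hi' j hj' => ?_
      simp only [mem_erase] at hi' hj'
      rw [Equiv.swap_apply_of_ne_of_ne hj'.2.1 hj'.1]
      simp only [hi'.1, hi'.2.1, hj'.1, hj'.2.1, hpj, or_self, if_false, kEntry, hd]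
      ring
    · intro i hi' hip
      simp only [mem_erase] at hi'
      simp [hpj, hmp, hi'.1, hip]
    · intro j _ hjj
      by_cases hjp : j = p
      · subst hjp
        simp [hpj]
      · simp [Equiv.swap_apply_of_ne_of_ne hjj hjp, hjj, hjp, hpj]
  rw [step1, step2, kappaOn]
  ring

end Cofactor

/-! ### Vertices cut off by the removed rows and columns -/

section Hypotheses

variable {V : Type*} {G : Digraph V}

theorem _root_.Digraph.StronglyConnectedOn.connOn {S : Finset V} (h : G.StronglyConnectedOn S) :
    ∀ a ∈ S, ∀ b ∈ S, ConnOn (und G) S a b := by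
  intro a ha b hb
  have := h a ha b hb
  clear hb
  induction this with
  | refl => exact .refl _
  | @tail y z _ h ih =>
    by_cases hyz : y = z
    · rwa [← hyz]
    · refine ih.tail ⟨h.1, h.2.1, ?_⟩
      rw [und, Digraph.toSimpleGraphInclusive, SimpleGraph.fromRel_adj]
      exact ⟨hyz, Or.inl h.2.2⟩

theorem ConnectedThroughUniqueCutVertex.exists_separating [Fintype V] [DecidableEq V]
    {I J : Finset V} (h : ConnectedThroughUniqueCutVertex G I J) {u : V} (hu : u ∈ I \ J) :
    ∃ v, v ∉ I ∪ J ∧ ∀ t ∉ I, ¬ ConnOn (und G) {v}ᶜ u t := by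
  obtain ⟨v, ⟨hv, -, hv'⟩, -⟩ := h u hu
  refine ⟨v, hv, fun t ht hut => ?_⟩
  have huv : u ≠ v := by
    rintro rfl
    exact hv (mem_union_left _ (mem_sdiff.1 hu).1)
  obtain ⟨p, hp⟩ := (exists_walk_notMem_iff huv).2 hut
  exact hp (hv' t ht p)

end Hypotheses

section Pendant

variable {V : Type*} [DecidableEq V] {G : Digraph V} {W : Finset V} {i p : V}

/-- A vertex that is separated by `p` from all other vertices of the connected set `W` is pendant
in the induced subgraph. -/
theorem adj_iff_of_separates (hW : ∀ a ∈ W, ∀ b ∈ W, ConnOn (und G) W a b) (hi : i ∈ W)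
    (hp : p ∈ W) (hip : i ≠ p) (hsep : ∀ z ∈ W, z ≠ i → ¬ ConnOn (und G) {p}ᶜ i z) :
    ∀ z ∈ W, (und G).Adj i z ↔ z = p := by
  have h1 : ∀ z ∈ W, (und G).Adj i z → z = p := by
    intro z hz h
    by_contra hzp
    exact hsep z hz h.ne' (.of_adj hip hzp h)
  intro z hz
  refine ⟨h1 z hz, ?_⟩
  rintro rfl
  obtain ⟨c, hc, hic⟩ := (hW i hi z hz).exists_adj hip
  rwa [← h1 c hc hic]

variable [Fintype V] [Nonempty V] (hG : ∀ a b, ConnOn (und G) Set.univ a b)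
include hG

/-- The trace of a block at a pendant vertex is an edge. -/
theorem trace_eq_pair (hip : i ≠ p)
    (hsep : ∀ z ∈ W, z ≠ i → ¬ ConnOn (und G) {p}ᶜ i z) {e : StrongBlock G} (hie : i ∈ e.1)
    (he : 2 ≤ #(e.1 ∩ W)) : e.1 ∩ W = {p, i} := by
  have h1 : e.1 ∩ W ⊆ {p, i} := by
    intro z hz
    rw [mem_inter] at hz
    rw [mem_insert, mem_singleton]
    by_contra h
    rw [not_or] at h
    exact hsep z hz.2 h.2 ((e.maximal hG).1 i hie z hz.1 p hip.symm (Ne.symm h.1))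
  exact eq_of_subset_of_card_le h1 ((card_le_two).trans he)

theorem exists_traceBlock_pair (hi : i ∈ W) (hp : p ∈ W) (hip : i ≠ p) (hadj : (und G).Adj i p)
    (hsep : ∀ z ∈ W, z ≠ i → ¬ ConnOn (und G) {p}ᶜ i z) :
    ∃ e : TraceBlock G W, e.verts = {p, i} := by
  obtain ⟨e, he⟩ := exists_strongBlock hG (insepSet_pair (Insep.of_adj hadj))
  have hie : i ∈ e.1 := he (by simp)
  have hpe : p ∈ e.1 := he (by simp)
  have h2 : 2 ≤ #(e.1 ∩ W) :=
    one_lt_card.2 ⟨i, mem_inter.2 ⟨hie, hi⟩, p, mem_inter.2 ⟨hpe, hp⟩, hip⟩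
  exact ⟨⟨e, h2⟩, trace_eq_pair hG hip hsep hie h2⟩

end Pendant

section MinorCases

variable {V : Type*} [Fintype V] [LinearOrder V] {R : Type*} [CommRing R] {G : Digraph V}
  (𝒢 : BlockDatum G R) (x : R) {I J : Finset V}

section

variable [Nonempty V] (hG : ∀ a b, ConnOn (und G) Set.univ a b)
include hG

/-- With two or more vertices in `J \ I`, their rows are multiples of the all-ones row modulo the
rows of the cut-vertices through which they are connected to the columns. -/
theorem minorDet_eq_zero (hIJ : #I = #J) (hJ : ConnectedThroughUniqueCutVertex G J I)
    (hcard : 2 ≤ #(J \ I)) : minorDet (𝒢.distMatrixAdd x) I J hIJ = 0 := by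
  obtain ⟨q₁, hq₁, q₂, hq₂, hq⟩ := one_lt_card.1 hcard
  obtain ⟨w₁, hw₁, hs₁⟩ := hJ.exists_separating hq₁
  obtain ⟨w₂, hw₂, hs₂⟩ := hJ.exists_separating hq₂
  have hJc : #Jᶜ = #Iᶜ := by rw [card_compl, card_compl, hIJ]
  have hrange : ∀ v ∉ I, ∃ k, Iᶜ.orderEmbOfFin rfl k = v := by
    intro v hv
    have : v ∈ Set.range (Iᶜ.orderEmbOfFin rfl) := by
      rw [range_orderEmbOfFin]; simpa using hv
    exact this
  rw [mem_union, not_or] at hw₁ hw₂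
  rw [mem_sdiff] at hq₁ hq₂
  obtain ⟨k₁, hk₁⟩ := hrange q₁ hq₁.2
  obtain ⟨k₂, hk₂⟩ := hrange q₂ hq₂.2
  obtain ⟨l₁, hl₁⟩ := hrange w₁ hw₁.2
  obtain ⟨l₂, hl₂⟩ := hrange w₂ hw₂.2
  have hrow : ∀ q w : V, (∀ t ∉ J, ¬ ConnOn (und G) {w}ᶜ q t) → ∀ t : Fin #Iᶜ,
      𝒢.distMatrixAdd x q (Jᶜ.orderEmbOfFin hJc t) =
        𝒢.mulDist q w * 𝒢.distMatrixAdd x w (Jᶜ.orderEmbOfFin hJc t) +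
          (𝒢.addDist q w + x * (1 - 𝒢.mulDist q w)) := by
    intro q w hs t
    have ht : Jᶜ.orderEmbOfFin hJc t ∉ J := mem_compl.1 (orderEmbOfFin_mem Jᶜ hJc t)
    simp only [BlockDatum.distMatrixAdd, Matrix.of_apply]
    rw [addDist_of_separates 𝒢 hG (i := q) (v := w) fun _ _ => hs _ ht]
    ring
  unfold minorDet
  refine det_eq_zero_of_two_rows (q₁ := k₁) (q₂ := k₂) (w₁ := l₁) (w₂ := l₂)
    (c₁ := 𝒢.mulDist q₁ w₁) (c₂ := 𝒢.mulDist q₂ w₂)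
    (b₁ := 𝒢.addDist q₁ w₁ + x * (1 - 𝒢.mulDist q₁ w₁))
    (b₂ := 𝒢.addDist q₂ w₂ + x * (1 - 𝒢.mulDist q₂ w₂)) ?_ ?_ ?_ ?_ ?_ ?_
  · rintro rfl; exact hq (hk₁.symm.trans hk₂)
  · rintro rfl; exact hw₁.1 (hl₁.symm.trans hk₁ ▸ hq₁.1)
  · rintro rfl; exact hw₂.1 (hl₂.symm.trans hk₂ ▸ hq₂.1)
  · rintro rfl; exact hw₂.1 (hl₂.symm.trans hk₁ ▸ hq₁.1)
  · intro t
    rw [Matrix.submatrix_apply, Matrix.submatrix_apply, hk₁, hl₁]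
    exact hrow q₁ w₁ hs₁ t
  · intro t
    rw [Matrix.submatrix_apply, Matrix.submatrix_apply, hk₂, hl₂]
    exact hrow q₂ w₂ hs₂ t

/-- Two vertices `i₀` and `j₀` that are pendant in the induced subgraph on `W`, with neighbors `p`
and `q`: the minor without the row of `i₀` and the column of `j₀`. -/
theorem minorDet_of_pendant {W : Finset V} {i₀ j₀ p q : V} (hIJ : #I = #J) (hi : i₀ ∈ W)
    (hj : j₀ ∈ W) (hI : Iᶜ = W.erase i₀) (hJ : Jᶜ = W.erase j₀) (hij : i₀ ≠ j₀)
    (hp : p ∈ W) (hq : q ∈ W) (hpi : p ≠ i₀) (hpj : p ≠ j₀) (hqi : q ≠ i₀) (hqj : q ≠ j₀)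
    (hIc : ∀ a ∈ Iᶜ, ∀ b ∈ Iᶜ, ConnOn (und G) (Iᶜ : Finset V) a b)
    (hsi : ∀ z ∈ W, z ≠ i₀ → ¬ ConnOn (und G) {p}ᶜ i₀ z)
    (hsj : ∀ z ∈ W, z ≠ j₀ → ¬ ConnOn (und G) {q}ᶜ j₀ z)
    (hadj : ∀ z ∈ W, (und G).Adj j₀ z → z = q) (ei ej : TraceBlock G W)
    (hei : ei.verts = {p, i₀}) (hej : ej.verts = {j₀, q})
    (r : (e : TraceBlock G W) → {v // v ∈ e.verts}) :
    minorDet (𝒢.distMatrixAdd x) I J hIJ =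
      (-1) ^ (#(W.filter (· < i₀)) + #(W.filter (· < j₀))) *
        ((∏ e ∈ univ \ {ei, ej}, 𝒢.traceKappa e (r e)) * 𝒢.traceWeight ei *
          (𝒢.traceWeight ej - x) * (𝒢.mulDist p i₀ - 1) * (𝒢.mulDist j₀ q - 1)) := by
  have hpA : p ∈ (W.erase i₀).erase j₀ := mem_erase.2 ⟨hpj, mem_erase.2 ⟨hpi, hp⟩⟩
  have hAW : (W.erase i₀).erase j₀ ⊆ W := (erase_subset _ _).trans (erase_subset _ _)
  have hconn : ∀ a ∈ (W.erase i₀).erase j₀, ∀ b ∈ (W.erase i₀).erase j₀,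
      ConnOn (und G) ((W.erase i₀).erase j₀ : Finset V) a b := by
    intro a ha b hb
    have h1 := hIc a (by rw [hI]; exact mem_of_mem_erase ha) b
      (by rw [hI]; exact mem_of_mem_erase hb)
    rw [hI] at h1
    have h2 := h1.diff_pendant (u := j₀) (c := q)
      (fun z hz h => hadj z (mem_of_mem_erase hz) h) (ne_of_mem_erase ha) (ne_of_mem_erase hb)
    rwa [coe_erase]
  have hpei : p ∈ ei.1.1 ∧ i₀ ∈ ei.1.1 := by
    constructor <;> refine (mem_inter.1 (?_ : _ ∈ ei.verts)).1 <;> rw [hei] <;> simp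
  have hqej : j₀ ∈ ej.1.1 ∧ q ∈ ej.1.1 := by
    constructor <;> refine (mem_inter.1 (?_ : _ ∈ ej.verts)).1 <;> rw [hej] <;> simp
  -- the blocks at `i₀` and `j₀` have trivial traces on the remaining set, other traces persist
  have hei1 : blockKappa 𝒢 ei.1 ((W.erase i₀).erase j₀) = 1 := by
    refine blockKappa_of_card_le_one 𝒢 hG ((card_le_card (t := {p}) ?_).trans
      (card_singleton p).le)
    intro z hz
    rw [mem_inter] at hz
    have h1 : z ∈ ei.verts := mem_inter.2 ⟨hz.1, hAW hz.2⟩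
    rw [hei, mem_insert, mem_singleton] at h1
    exact mem_singleton.2 (h1.resolve_right (ne_of_mem_erase (mem_of_mem_erase hz.2)))
  have hej1 : blockKappa 𝒢 ej.1 ((W.erase i₀).erase j₀) = 1 := by
    refine blockKappa_of_card_le_one 𝒢 hG ((card_le_card (t := {q}) ?_).trans
      (card_singleton q).le)
    intro z hz
    rw [mem_inter] at hz
    have h1 : z ∈ ej.verts := mem_inter.2 ⟨hz.1, hAW hz.2⟩
    rw [hej, mem_insert, mem_singleton] at h1
    exact mem_singleton.2 (h1.resolve_left (ne_of_mem_erase hz.2))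
  have hother : ∀ e : StrongBlock G, e ≠ ei.1 → e ≠ ej.1 →
      blockKappa 𝒢 e ((W.erase i₀).erase j₀) = blockKappa 𝒢 e W := by
    intro e he1 he2
    by_cases hcard : 2 ≤ #(e.1 ∩ W)
    · refine blockKappa_congr 𝒢 ?_
      have hie : i₀ ∉ e.1 := fun h => by
        have h1 := trace_eq_pair hG hpi.symm hsi h hcard
        have h2 : p ∈ e.1 ∩ W := by rw [h1]; simp
        exact he1 (strongBlock_eq hG hpi (mem_inter.1 h2).1 h hpei.1 hpei.2)
      have hje : j₀ ∉ e.1 := fun h => by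
        have h1 := trace_eq_pair hG hqj.symm hsj h hcard
        have h2 : q ∈ e.1 ∩ W := by rw [h1]; simp
        exact he2 (strongBlock_eq hG hqj (mem_inter.1 h2).1 h hqej.2 hqej.1)
      ext z
      simp only [mem_inter, mem_erase]
      constructor
      · rintro ⟨h1, -, -, h2⟩; exact ⟨h1, h2⟩
      · rintro ⟨h1, h2⟩
        exact ⟨h1, fun h => hje (h ▸ h1), fun h => hie (h ▸ h1), h2⟩
    · have h1 : #(e.1 ∩ (W.erase i₀).erase j₀) ≤ #(e.1 ∩ W) :=
        card_le_card (inter_subset_inter_left hAW)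
      rw [blockKappa_of_card_le_one 𝒢 hG (W := W) (by omega),
        blockKappa_of_card_le_one 𝒢 hG (by omega)]
  have hkappa : kappaOn 𝒢.mulDist 𝒢.addDist ((W.erase i₀).erase j₀) p =
      ∏ e ∈ univ \ {ei, ej}, 𝒢.traceKappa e (r e) := by
    rw [(kappaOn_and_detOn 𝒢 hG x hconn ⟨p, hpA⟩).1 p hpA,
      prod_traceKappa 𝒢 hG r _ (univ \ {ei.1, ej.1}) (by
        intro e; simp [Subtype.ext_iff])]
    rw [← prod_sdiff (subset_univ {ei.1, ej.1}), mul_comm, prod_eq_one, one_mul]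
    · refine prod_congr rfl fun e he => ?_
      simp only [mem_sdiff, mem_univ, true_and, mem_insert, mem_singleton, not_or] at he
      exact hother e he.1 he.2
    · intro e he
      rw [mem_insert, mem_singleton] at he
      rcases he with rfl | rfl
      exacts [hei1, hej1]
  have hcof := detOn_cofactor (m := 𝒢.mulDist) (d := 𝒢.addDist) (x := x) hi hj hp hq hij hpi hpj
    hqi hqj
    (fun z hz hzi => addDist_of_separates 𝒢 hG fun _ _ h => hsi z hz hzi h.symm)
    (fun z hz hzj => addDist_of_separates 𝒢 hG fun _ _ h => hsj z hz hzj h)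
    (mulDist_of_separates 𝒢 hG fun _ _ h => hsj p hp hpj h)
    (addDist_self 𝒢 hG p) (mulDist_self 𝒢 hG p)
  rw [minorDet_eq_cofactor _ hIJ hi hj hI hJ]
  congr 1
  refine hcof.trans ?_
  rw [hkappa, addDist_block 𝒢 hG ei.1 hpei.1 hpei.2, addDist_block 𝒢 hG ej.1 hqej.1 hqej.2]
  unfold BlockDatum.traceWeight
  ring

end

end MinorCases

end AMDist

theorem theoremB {V : Type*} [Fintype V] [LinearOrder V] {R : Type*} [CommRing R]
    (G : Digraph V) (hG : G.StronglyConnectedOn Finset.univ)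
    (𝒢 : AMDist.BlockDatum G R) (x : R) (I J : Finset V)
    (hIJ : I.card = J.card) (hcard : I.card + 3 ≤ Fintype.card V)
    (hI : AMDist.ConnectedThroughUniqueCutVertex G I J)
    (hJ : AMDist.ConnectedThroughUniqueCutVertex G J I)
    (hIc : G.StronglyConnectedOn Iᶜ) (hJc : G.StronglyConnectedOn Jᶜ)
    (hIJc : G.StronglyConnectedOn (I ∩ J)ᶜ)
    -- an arbitrary base vertex in every block, with respect to which `κ` is computed
    (r : (e : AMDist.TraceBlock G (I ∩ J)ᶜ) → {v // v ∈ e.verts}) :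
    -- if the traces of the blocks have no cut-vertices, they are the strong blocks of the
    -- induced subgraph
    ((∀ e : AMDist.TraceBlock G (I ∩ J)ᶜ, AMDist.Nonseparable G e.verts) →
      ∀ B : Finset V, AMDist.IsBlockIn G (I ∩ J)ᶜ B ↔
        ∃ e : AMDist.TraceBlock G (I ∩ J)ᶜ, e.verts = B) ∧
    -- the case `|I Δ J| = 0`
    ((symmDiff I J).card = 0 →
      AMDist.minorDet (𝒢.distMatrixAdd x) I J hIJ =
        x * ∏ e, 𝒢.traceKappa e (r e) +
          ∑ e, (𝒢.traceWeight e - x) *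
            (𝒢.traceKappa e (r e) - AMDist.cofSum (𝒢.traceDist e)) *
              ∏ f ∈ Finset.univ.erase e, 𝒢.traceKappa f (r f)) ∧
    -- the case `|I Δ J| = 2`
    ((symmDiff I J).card = 2 →
      ∃ (i₀ j₀ pi pj : V) (ei ej : AMDist.TraceBlock G (I ∩ J)ᶜ),
        I \ J = {i₀} ∧ J \ I = {j₀} ∧ pi ∉ I ∪ J ∧ pj ∉ I ∪ J ∧
        -- `i₀`, `j₀` are pendant in the induced subgraph, with unique neighbors `pi`, `pj`
        (∀ v ∈ (I ∩ J)ᶜ, (AMDist.und G).Adj i₀ v ↔ v = pi) ∧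
        (∀ v ∈ (I ∩ J)ᶜ, (AMDist.und G).Adj j₀ v ↔ v = pj) ∧
        ei.verts = {pi, i₀} ∧ ej.verts = {j₀, pj} ∧ ei ≠ ej ∧
        (∀ P : R,
          P = (∏ e ∈ Finset.univ \ {ei, ej}, 𝒢.traceKappa e (r e)) *
            𝒢.traceWeight ei * (𝒢.traceWeight ej - x) *
            (𝒢.mulDist pi i₀ - 1) * (𝒢.mulDist j₀ pj - 1) →
          AMDist.minorDet (𝒢.distMatrixAdd x) I J hIJ =
            (-1) ^ (((I ∩ J)ᶜ.filter (· < i₀)).card + ((I ∩ J)ᶜ.filter (· < j₀)).card) * P ∧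
          -- the sign when `i₀` comes first and `j₀` comes last
          ((∀ v ∈ (I ∩ J)ᶜ, i₀ ≤ v ∧ v ≤ j₀) →
            AMDist.minorDet (𝒢.distMatrixAdd x) I J hIJ =
              (-1) ^ ((I ∩ J)ᶜ.card - 1) * P))) ∧
    -- the case `|I Δ J| > 2`
    (2 < (symmDiff I J).card →
      AMDist.minorDet (𝒢.distMatrixAdd x) I J hIJ = 0) := by
  have hcon : ∀ a b, AMDist.ConnOn (AMDist.und G) Set.univ a b := fun a b =>
    (hG.connOn a (Finset.mem_univ a) b (Finset.mem_univ b)).mono (Set.subset_univ _)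
  have hne : Nonempty V := Fintype.card_pos_iff.1 (by omega)
  have hcW : 3 ≤ ((I ∩ J)ᶜ).card := by
    have h1 := Finset.card_le_card (Finset.inter_subset_left (s₁ := I) (s₂ := J))
    rw [Finset.card_compl]
    omega
  have hsymm : (symmDiff I J).card = 2 * (J \ I).card := by
    have h1 := Finset.card_sdiff_add_card_inter I J
    have h2 := Finset.card_sdiff_add_card_inter J I
    rw [Finset.inter_comm] at h2
    rw [symmDiff_def, Finset.sup_eq_union, Finset.card_union_of_disjoint disjoint_sdiff_sdiff]
    omega
  refine ⟨fun htr B => AMDist.isBlockIn_iff_traceBlock hcon hIJc.connOn (by omega) htr B, ?_, ?_,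
    fun h => AMDist.minorDet_eq_zero 𝒢 x hcon hIJ hJ (by omega)⟩
  · intro h
    obtain rfl : I = J := by
      rw [Finset.card_eq_zero] at h
      exact symmDiff_eq_bot.1 h
    rw [← AMDist.detOn_eq_sum_traceBlock 𝒢 hcon x hIJc.connOn (Finset.card_pos.1 (by omega)) r,
      AMDist.minorDet_self, Finset.inter_self]
    rfl
  · intro h
    have hJ1 : (J \ I).card = 1 := by omega
    have hI1 : (I \ J).card = 1 := by
      have h1 := Finset.card_sdiff_add_card_inter I J
      have h2 := Finset.card_sdiff_add_card_inter J I
      rw [Finset.inter_comm] at h2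
      omega
    obtain ⟨i₀, hi₀⟩ := Finset.card_eq_one.1 hI1
    obtain ⟨j₀, hj₀⟩ := Finset.card_eq_one.1 hJ1
    have hi : i₀ ∈ I \ J := by rw [hi₀]; exact Finset.mem_singleton_self i₀
    have hj : j₀ ∈ J \ I := by rw [hj₀]; exact Finset.mem_singleton_self j₀
    obtain ⟨p, hp, hsp⟩ := hI.exists_separating hi
    obtain ⟨q, hq, hsq⟩ := hJ.exists_separating hj
    rw [Finset.union_comm] at hq
    have hIW : Iᶜ = ((I ∩ J)ᶜ).erase i₀ := by
      ext z
      have := Finset.ext_iff.1 hi₀ z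
      simp only [Finset.mem_sdiff, Finset.mem_singleton] at this
      simp only [Finset.mem_compl, Finset.mem_erase, Finset.mem_inter]
      tauto
    have hJW : Jᶜ = ((I ∩ J)ᶜ).erase j₀ := by
      ext z
      have := Finset.ext_iff.1 hj₀ z
      simp only [Finset.mem_sdiff, Finset.mem_singleton] at this
      simp only [Finset.mem_compl, Finset.mem_erase, Finset.mem_inter]
      tauto
    have hsi : ∀ z ∈ (I ∩ J)ᶜ, z ≠ i₀ → ¬ AMDist.ConnOn (AMDist.und G) {p}ᶜ i₀ z :=
      fun z hz hzi => hsp z (Finset.mem_compl.1 (by rw [hIW]; exact Finset.mem_erase.2 ⟨hzi, hz⟩))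
    have hsj : ∀ z ∈ (I ∩ J)ᶜ, z ≠ j₀ → ¬ AMDist.ConnOn (AMDist.und G) {q}ᶜ j₀ z :=
      fun z hz hzj => hsq z (Finset.mem_compl.1 (by rw [hJW]; exact Finset.mem_erase.2 ⟨hzj, hz⟩))
    rw [Finset.mem_sdiff] at hi hj
    have hiW : i₀ ∈ (I ∩ J)ᶜ := by simp [hi.2]
    have hjW : j₀ ∈ (I ∩ J)ᶜ := by simp [hj.2]
    have hpIJ : p ∉ I ∧ p ∉ J := by rwa [Finset.mem_union, not_or] at hp
    have hqIJ : q ∉ I ∧ q ∉ J := by rwa [Finset.mem_union, not_or] at hq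
    have hpW : p ∈ (I ∩ J)ᶜ := by simp [hpIJ.1]
    have hqW : q ∈ (I ∩ J)ᶜ := by simp [hqIJ.1]
    have hij : i₀ ≠ j₀ := fun h => hj.2 (h ▸ hi.1)
    have hpi : p ≠ i₀ := fun h => hpIJ.1 (h ▸ hi.1)
    have hpj : p ≠ j₀ := fun h => hpIJ.2 (h ▸ hj.1)
    have hqi : q ≠ i₀ := fun h => hqIJ.1 (h ▸ hi.1)
    have hqj : q ≠ j₀ := fun h => hqIJ.2 (h ▸ hj.1)
    have hai := AMDist.adj_iff_of_separates hIJc.connOn hiW hpW hpi.symm hsi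
    have haj := AMDist.adj_iff_of_separates hIJc.connOn hjW hqW hqj.symm hsj
    obtain ⟨ei, hei⟩ := AMDist.exists_traceBlock_pair hcon hiW hpW hpi.symm
      ((hai p hpW).2 rfl) hsi
    obtain ⟨ej, hej⟩ := AMDist.exists_traceBlock_pair hcon hjW hqW hqj.symm
      ((haj q hqW).2 rfl) hsj
    rw [Finset.pair_comm] at hej
    have hmain := AMDist.minorDet_of_pendant 𝒢 x hcon hIJ hiW hjW hIW hJW hij hpW hqW hpi hpj hqi
      hqj hIc.connOn hsi hsj (fun z hz => (haj z hz).1) ei ej hei hej r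
    refine ⟨i₀, j₀, p, q, ei, ej, hi₀, hj₀, hp, hq, hai, haj, hei, hej, ?_, ?_⟩
    · rintro rfl
      have h1 : i₀ ∈ ({j₀, q} : Finset V) := by rw [← hej, hei]; simp
      rw [Finset.mem_insert, Finset.mem_singleton] at h1
      exact h1.elim hij hqi.symm
    · rintro P rfl
      refine ⟨hmain, fun hfl => ?_⟩
      have h1 : ((I ∩ J)ᶜ.filter (· < i₀)) = ∅ :=
        Finset.filter_eq_empty_iff.2 fun v hv => not_lt.2 (hfl v hv).1
      have h2 : ((I ∩ J)ᶜ.filter (· < j₀)) = ((I ∩ J)ᶜ).erase j₀ := by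
        ext v
        rw [Finset.mem_filter, Finset.mem_erase]
        exact ⟨fun h => ⟨h.2.ne, h.1⟩, fun h => ⟨h.2, lt_of_le_of_ne (hfl v h.2).2 h.1⟩⟩
      rw [hmain, h1, h2, Finset.card_erase_of_mem hjW, Finset.card_empty, zero_add]
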